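/- Let $d\ge 1$ be an integer, $\lambda>0$ and $0\le b<a\le 1$. Let $X_1,X_2,\dots$ be the points of a homogeneous Poisson point process of intensity $\lambda$ on $\mathbb{R}^d$, enumerated by increasing $\ell^\infty$ norm. Let $(Z_i)_{i\ge 1}$ be i.i.d. uniform on $\{-1,+1\}$ and let $(U_{ij})_{i<j}$ be i.i.d. uniform on $[0,1]$ with $U_{ji}=U_{ij}$, where the points, the family $(Z_i)$ and the family $(U_{ij})$ are independent of one another. For $n\in\mathbb{N}$ let $B_n=[-n^{1/d}/2,\,n^{1/d}/2]^d$, equipped with the toroidal distance $$\|x-y\|_{\mathcal{T}_n}=\Big\|\big(\min(|x_k-y_k|,\;n^{1/d}-|x_k-y_k|)\big)_{k=1}^d\Big\|_2,$$ and let $N_n$ be the number of points in $B_n$, so that these points are $X_1,\dots,X_{N_n}$. Let $G_n$ be the random graph with vertex set $\{1,\dots,N_n\}$ in which distinct vertices $i,j$ are joined by an edge if and only if $$U_{ij}\le f_{in}^{(n)}(\|X_i-X_j\|_{\mathcal{T}_n})\,\mathbf{1}\{Z_i=Z_j\}+f_{out}^{(n)}(\|X_i-X_j\|_{\mathcal{T}_n})\,\mathbf{1}\{Z_i\ne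 Z_j\},$$ where $f_{in}^{(n)}(r)=a\,\mathbf{1}\{r\le \log(n)^{1/d}\}$ and $f_{out}^{(n)}(r)=b\,\mathbf{1}\{r\le \log(n)^{1/d}\}$. Exact recovery is called solvable if there are $\{-1,+1\}$-valued estimators $(\tau_i^{(n)})_{i=1}^{N_n}$, for $n\in\mathbb{N}$, that are deterministic measurable functions of $G_n$ and $(X_1,\dots,X_{N_n})$, such that $$\lim_{n\to\infty}\mathbb{P}[\mathcal{O}_n=1]=1,\qquad \mathcal{O}_n=\frac{1}{N_n}\Big|\sum_{i=1}^{N_n}\tau_i^{(n)}Z_i\Big|\quad(\mathcal{O}_n=1\text{ if }N_n=0).$$ Let $\nu_d$ be the volume of the Euclidean unit ball in $\mathbb{R}^d$. If $$\lambda\,\nu_d\,\big(1-\sqrt{ab}-\sqrt{(1-a)(1-b)}\big)<1,$$ then exact recovery is not solvable. -/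

import Mathlib

open MeasureTheory ProbabilityTheory Filter Topology

noncomputable section

namespace PlantedPartition

instance instDiscreteMeasurableSpaceIntUnits : DiscreteMeasurableSpace ℤˣ :=
  ⟨fun s => ⟨Units.val '' s, trivial, Set.preimage_image_eq s Units.val_injective⟩⟩

/-- `d`-dimensional space with the Euclidean norm. -/
abbrev Space (d : ℕ) : Type := EuclideanSpace ℝ (Fin d)

/-- The number of indices `i` with `X i ω ∈ B` (possibly infinite). -/
def count {Ω : Type*} {d : ℕ} (X : ℕ → Ω → Space d) (B : Set (Space d)) (ω : Ω) : ℕ∞ :=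
  {i : ℕ | X i ω ∈ B}.encard

/-- `X 0, X 1, …` enumerates a homogeneous Poisson point process of intensity `lam` on `ℝ^d`. -/
structure IsPoissonProcess {Ω : Type*} [MeasurableSpace Ω] (P : Measure Ω) {d : ℕ} (lam : ℝ)
    (X : ℕ → Ω → Space d) : Prop where
  measurable : ∀ i, Measurable (X i)
  /-- The number of points in a bounded Borel set `B` is Poisson with mean `lam * |B|`. -/
  law_count : ∀ B : Set (Space d), MeasurableSet B → Bornology.IsBounded B →
    HasLaw (count X B)
      ((poissonMeasure (lam * volume.real B).toNNReal).map (fun k : ℕ => (k : ℕ∞))) P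
  /-- The numbers of points in disjoint bounded Borel sets are mutually independent. -/
  indep_count : ∀ (k : ℕ) (B : Fin k → Set (Space d)), (∀ i, MeasurableSet (B i)) →
    (∀ i, Bornology.IsBounded (B i)) → (∀ i j, i ≠ j → Disjoint (B i) (B j)) →
    iIndepFun (fun i => count X (B i)) P

/-- The unordered pairs of distinct indices. -/
abbrev Pairs : Type := {e : Sym2 ℕ // ¬ e.IsDiag}

/-- A marked Poisson point process: the points `X i` of a homogeneous Poisson process of intensity
`lam` on `ℝ^d`, enumerated by increasing `ℓ^∞` norm, with independent marks: i.i.d. uniform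
community labels `Z i ∈ {-1, +1}`, and i.i.d. uniform variables `U s(i, j) ∈ [0, 1]` for the
unordered pairs `i ≠ j`. -/
structure IsMarkedPoissonProcess {Ω : Type*} [MeasurableSpace Ω] (P : Measure Ω) {d : ℕ} (lam : ℝ)
    (X : ℕ → Ω → Space d) (Z : ℕ → Ω → ℤˣ) (U : Sym2 ℕ → Ω → ℝ) : Prop where
  poisson : IsPoissonProcess P lam X
  /-- `‖WithLp.ofLp x‖` is the maximum norm of `x`. -/
  ordered : ∀ᵐ ω ∂P, ∀ i j : ℕ, j < i → ‖WithLp.ofLp (X j ω)‖ ≤ ‖WithLp.ofLp (X i ω)‖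
  measurable_Z : ∀ i, Measurable (Z i)
  law_Z : ∀ i (s : ℤˣ), P {ω | Z i ω = s} = 1 / 2
  indep_Z : iIndepFun Z P
  measurable_U : ∀ e, Measurable (U e)
  law_U : ∀ e : Pairs, HasLaw (U e) (volume.restrict (Set.Icc (0 : ℝ) 1)) P
  indep_U : iIndepFun (fun e : Pairs => U e) P
  /-- The labels are independent of the edge variables, and all marks of the points. -/
  indep_Z_U : IndepFun (fun ω i => Z i ω) (fun ω (e : Pairs) => U e ω) P
  indep_X_marks : IndepFun (fun ω i => X i ω)
    (fun ω => ((fun i => Z i ω), (fun e : Pairs => U e ω))) P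

/-- The side length `n^{1/d}` of the cube of volume `n`. -/
def side (d n : ℕ) : ℝ := (n : ℝ) ^ (1 / (d : ℝ))

/-- The cube `B_n = [-n^{1/d}/2, n^{1/d}/2]^d`. -/
def cube (d n : ℕ) : Set (Space d) :=
  {x | ∀ k, x k ∈ Set.Icc (-(side d n / 2)) (side d n / 2)}

/-- The toroidal distance on the cube `B_n`. -/
def torusDist {d : ℕ} (n : ℕ) (x y : Space d) : ℝ :=
  ‖WithLp.toLp 2 (fun k : Fin d => min |x k - y k| (side d n - |x k - y k|))‖

/-- The number `N_n` of points in `B_n`; as the points are ordered, these are almost surely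
the points with the indices `0, …, N_n - 1`. -/
def numNodes {Ω : Type*} {d : ℕ} (X : ℕ → Ω → Space d) (n : ℕ) (ω : Ω) : ℕ :=
  {i : ℕ | X i ω ∈ cube d n}.ncard

/-- The locations of the nodes of `G_n`. -/
def locations {Ω : Type*} {d : ℕ} (X : ℕ → Ω → Space d) (n : ℕ) (ω : Ω) :
    Fin (numNodes X n ω) → Space d :=
  fun i => X i ω

/-- The community labels of the nodes of `G_n`. -/
def labels {Ω : Type*} {d : ℕ} (X : ℕ → Ω → Space d) (Z : ℕ → Ω → ℤˣ) (n : ℕ) (ω : Ω) :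
    Fin (numNodes X n ω) → ℤˣ :=
  fun i => Z i ω

/-- The random graph `G_n` with connection functions `fin` and `fout`: nodes `i ≠ j` are joined
if and only if `U s(i, j)` is at most the connection function of their toroidal distance. -/
def graph {Ω : Type*} {d : ℕ} (X : ℕ → Ω → Space d) (Z : ℕ → Ω → ℤˣ) (U : Sym2 ℕ → Ω → ℝ)
    (fin fout : ℕ → ℝ → ℝ) (n : ℕ) (ω : Ω) : SimpleGraph (Fin (numNodes X n ω)) where
  Adj i j := i ≠ j ∧ U s((i : ℕ), (j : ℕ)) ω ≤
    if Z i ω = Z j ω then fin n (torusDist n (X i ω) (X j ω))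
    else fout n (torusDist n (X i ω) (X j ω))
  symm := ⟨by
    rintro i j ⟨hij, h⟩
    refine ⟨hij.symm, ?_⟩
    have ht : torusDist n (X j ω) (X i ω) = torusDist n (X i ω) (X j ω) := by
      simp only [torusDist, abs_sub_comm]
    rw [Sym2.eq_swap, ht]
    simpa only [eq_comm] using h⟩
  loopless := ⟨fun _ h => h.1 rfl⟩

/-- The overlap of two label sequences, equal to `1` for empty sequences. -/
def overlap {t : ℕ} (x y : Fin t → ℤˣ) : ℝ :=
  if t = 0 then 1 else |∑ i, (((x i : ℤ) : ℝ) * ((y i : ℤ) : ℝ))| / (t : ℝ)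

/-- Exact recovery is solvable: some estimators `τ n`, which are deterministic (measurable)
functions of the locations of the nodes and of the graph `G_n`, have overlap `1` with the true
labels with probability tending to `1`. -/
def ExactRecoverySolvable {Ω : Type*} [MeasurableSpace Ω] (P : Measure Ω) {d : ℕ}
    (X : ℕ → Ω → Space d) (Z : ℕ → Ω → ℤˣ) (U : Sym2 ℕ → Ω → ℝ)
    (fin fout : ℕ → ℝ → ℝ) : Prop :=
  ∃ τ : (n : ℕ) → (N : ℕ) → (Fin N → Space d) → SimpleGraph (Fin N) → (Fin N → ℤˣ),
    (∀ n N (G : SimpleGraph (Fin N)), Measurable (fun x => τ n N x G)) ∧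
    Tendsto
      (fun n : ℕ => P {ω | overlap
        (τ n (numNodes X n ω) (locations X n ω) (graph X Z U fin fout n ω)) (labels X Z n ω) = 1})
      atTop (𝓝 1)

/-- The connection functions `r ↦ c · 1{r ≤ log(n)^{1/d}}`. -/
def logConn (d : ℕ) (c : ℝ) (n : ℕ) (r : ℝ) : ℝ :=
  if r ≤ (Real.log n) ^ (1 / (d : ℝ)) then c else 0

/-- The volume `ν_d` of the Euclidean unit ball of `ℝ^d`. -/
def unitBallVolume (d : ℕ) : ℝ := volume.real (Metric.ball (0 : Space d) 1)

end PlantedPartition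

end

/-! Given the locations, the labels are uniform and the graph has an explicit law, a product over
pairs of nodes. Call a node ambiguous if reversing its label does not lower this likelihood. An
estimate has overlap one with at most two labellings, itself and its negative. As soon as there are
two nodes, reversing one ambiguous node moves a labelling out of this pair to one that is at least
as likely. Summing over graphs, the probability that an ambiguous node exists is at most three times
the failure probability of any estimator (`sum_le_three_mul_sum`, `real_flippable_le`). So it
suffices that an ambiguous node exists with probability tending to one.

A node with `m` visible neighbours sees `m` i.i.d. pairs (relative label, edge). Reversing its label
exchanges two hypotheses about these pairs, whose Bhattacharyya coefficient is `ρ = √(ab) +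
√((1-a)(1-b))`. A method-of-types estimate shows that the node is ambiguous with probability at
least `C r ^ m`, for any `r` slightly below `ρ` (or `r = 0` if `ρ = 0`); this is `exists_rate`.

To get independent trials, take a grid of about `n / log n` centres whose balls of radius `R + 1`,
with `R ^ d = log n`, are disjoint and do not meet the torus boundary. If the unit ball around a
centre contains exactly one point, then all nodes visible from it lie in the surrounding annulus,
which belongs to this cell alone. Averaging `r ^ m` over the Poisson number of points in the annulus
gives at least `exp (-λ ν_d (1 - r) (R + 1) ^ d)`, which is `n ^ (-κ + o(1))` with `κ = λ ν_d (1 -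
r) < 1`. The expected number of successful cells thus diverges (`exists_grid_size`), and by
independence the probability that none succeeds tends to zero (`real_not_flippable_pattern_le`). -/

namespace PlantedPartition

/-! ### Lower bounds for the affinity of product weights, by the method of types -/

section Affinity

variable {S : Type*} [Fintype S]

/-- The total affinity `∑ min (p, p')` of the `ι`-fold products of two weights `q` and `q'`. -/
noncomputable def affinity (q q' : S → ℝ) (ι : Type*) [Fintype ι] [DecidableEq ι] : ℝ :=
  ∑ σ : ι → S, min (∏ j, q (σ j)) (∏ j, q' (σ j))

lemma affinity_congr (q q' : S → ℝ) {ι κ : Type*} [Fintype ι] [DecidableEq ι] [Fintype κ]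
    [DecidableEq κ] (e : ι ≃ κ) : affinity q q' ι = affinity q q' κ := by
  unfold affinity
  refine Fintype.sum_equiv (Equiv.arrowCongr e (Equiv.refl S)) _ _ fun σ => ?_
  congr 1 <;> exact Fintype.prod_equiv e _ _ fun j => by simp

/-- A product of minima is at most the minimum of the products. This serves to pass from even to odd
numbers of factors. -/
lemma affinity_mul_le {q q' : S → ℝ} (hq : ∀ s, 0 ≤ q s) (hq' : ∀ s, 0 ≤ q' s)
    (ι κ : Type*) [Fintype ι] [DecidableEq ι] [Fintype κ] [DecidableEq κ] :
    affinity q q' ι * affinity q q' κ ≤ affinity q q' (ι ⊕ κ) := by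
  unfold affinity
  rw [Finset.sum_mul_sum, ← Fintype.sum_prod_type',
    ← (Equiv.sumArrowEquivProdArrow ι κ S).symm.sum_comp]
  refine Finset.sum_le_sum fun σ _ => ?_
  have h1 : 0 ≤ ∏ j, q (σ.1 j) := Finset.prod_nonneg fun _ _ => hq _
  have h2 : 0 ≤ ∏ j, q' (σ.1 j) := Finset.prod_nonneg fun _ _ => hq' _
  have h3 : 0 ≤ ∏ j, q (σ.2 j) := Finset.prod_nonneg fun _ _ => hq _
  have h4 : 0 ≤ ∏ j, q' (σ.2 j) := Finset.prod_nonneg fun _ _ => hq' _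
  simp only [Fintype.prod_sum_type, Equiv.sumArrowEquivProdArrow, Equiv.coe_fn_symm_mk,
    Sum.elim_inl, Sum.elim_inr]
  refine le_min ?_ ?_
  · exact mul_le_mul (min_le_left _ _) (min_le_left _ _) (le_min h3 h4) h1
  · exact mul_le_mul (min_le_right _ _) (min_le_right _ _) (le_min h3 h4) h2

lemma prod_eq_prod_pow_card [DecidableEq S] {ι : Type*} [Fintype ι] (f : S → ℝ) (σ : ι → S) :
    ∏ j, f (σ j) = ∏ s, f s ^ Fintype.card {j // σ j = s} := by
  rw [← Finset.prod_fiberwise' Finset.univ σ f]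
  refine Finset.prod_congr rfl fun s _ => ?_
  rw [Finset.prod_const, Fintype.card_subtype]

/-- The symmetry `φ` turns the affinity of a doubled product into a sum of `min (p σ * p' σ') (p' σ
* p σ')`. When `σ` and `σ'` have the same type (the same symbol counts) the two arguments agree, so
nothing is lost on these pairs. There are only polynomially many types, and Cauchy–Schwarz over the
types costs just this factor. -/
lemma sqrt_sum_pow_le_affinity (φ : S ≃ S) {q q' : S → ℝ} (hq : ∀ s, 0 ≤ q s)
    (h1 : ∀ s, q (φ s) = q' s) (h2 : ∀ s, q' (φ s) = q s)
    (ι : Type*) [Fintype ι] [DecidableEq ι] :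
    (∑ s, √(q s * q' s)) ^ (2 * Fintype.card ι)
      ≤ ((Fintype.card ι : ℝ) + 1) ^ Fintype.card S * affinity q q' (ι ⊕ ι) := by
  classical
  have hq' : ∀ s, 0 ≤ q' s := fun s => h1 s ▸ hq _
  -- The type of `σ`, on which alone both product weights depend.
  let K : (ι → S) → (S → Fin (Fintype.card ι + 1)) := fun σ s =>
    ⟨Fintype.card {j // σ j = s}, Nat.lt_succ_of_le (Fintype.card_subtype_le _)⟩
  let p : (ι → S) → ℝ := fun σ => ∏ j, q (σ j)
  let p' : (ι → S) → ℝ := fun σ => ∏ j, q' (σ j)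
  have hp : ∀ σ, 0 ≤ p σ := fun σ => Finset.prod_nonneg fun _ _ => hq _
  have hp' : ∀ σ, 0 ≤ p' σ := fun σ => Finset.prod_nonneg fun _ _ => hq' _
  have hK : ∀ σ σ', K σ = K σ' → p σ = p σ' ∧ p' σ = p' σ' := by
    intro σ σ' h
    have h0 : ∀ s, Fintype.card {j // σ j = s} = Fintype.card {j // σ' j = s} :=
      fun s => congrArg Fin.val (congrFun h s)
    simp only [p, p', prod_eq_prod_pow_card _ σ, prod_eq_prod_pow_card _ σ', h0, and_self]
  have hsum : affinity q q' (ι ⊕ ι) =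
      ∑ σ, ∑ σ', min (p σ * p' σ') (p' σ * p σ') := by
    unfold affinity
    rw [← (Equiv.sumArrowEquivProdArrow ι ι S).symm.sum_comp, Fintype.sum_prod_type]
    refine Finset.sum_congr rfl fun σ _ => ?_
    -- Substituting `φ` in the second half only exchanges `p` and `p'` there.
    rw [← (Equiv.arrowCongr (Equiv.refl ι) φ).sum_comp]
    refine Finset.sum_congr rfl fun σ' _ => ?_
    simp [Fintype.prod_sum_type, Equiv.sumArrowEquivProdArrow, p, p', h1, h2]
  have hpow : (∑ s, √(q s * q' s)) ^ Fintype.card ι = ∑ σ, √(p σ * p' σ) := by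
    rw [← Finset.card_univ, ← Finset.prod_const, Finset.prod_univ_sum, Fintype.piFinset_univ]
    refine Finset.sum_congr rfl fun σ _ => ?_
    rw [← Finset.prod_mul_distrib, Real.sqrt_eq_rpow,
      ← Real.finsetProd_rpow _ _ fun i _ => mul_nonneg (hq _) (hq' _)]
    simp [Real.sqrt_eq_rpow]
  have hfib : ∑ σ, √(p σ * p' σ) = ∑ k, ∑ σ with K σ = k, √(p σ * p' σ) :=
    (Finset.sum_fiberwise _ _ _).symm
  have hfib2 : ∀ k, (∑ σ with K σ = k, √(p σ * p' σ)) ^ 2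
      = ∑ σ with K σ = k, ∑ σ' with K σ' = k, min (p σ * p' σ') (p' σ * p σ') := by
    intro k
    rw [sq, Finset.sum_mul_sum]
    refine Finset.sum_congr rfl fun σ hσ => Finset.sum_congr rfl fun σ' hσ' => ?_
    obtain ⟨e1, e2⟩ := hK σ σ' (by simp_all)
    rw [e1, e2, Real.mul_self_sqrt (mul_nonneg (hp _) (hp' _)), mul_comm (p' σ'), min_self]
  have hnn : ∀ σ σ', 0 ≤ min (p σ * p' σ') (p' σ * p σ') := fun σ σ' =>
    le_min (mul_nonneg (hp _) (hp' _)) (mul_nonneg (hp' _) (hp _))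
  calc (∑ s, √(q s * q' s)) ^ (2 * Fintype.card ι)
      = (∑ k, ∑ σ with K σ = k, √(p σ * p' σ)) ^ 2 := by
        rw [mul_comm, pow_mul, hpow, hfib]
    _ ≤ (Finset.univ : Finset (S → Fin (Fintype.card ι + 1))).card *
          ∑ k, (∑ σ with K σ = k, √(p σ * p' σ)) ^ 2 := sq_sum_le_card_mul_sum_sq
    _ ≤ ((Fintype.card ι : ℝ) + 1) ^ Fintype.card S * affinity q q' (ι ⊕ ι) := by
        rw [Finset.card_univ, Fintype.card_fun, Fintype.card_fin]
        push_cast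
        refine mul_le_mul_of_nonneg_left ?_ (by positivity)
        rw [hsum, ← Finset.sum_fiberwise Finset.univ K]
        refine Finset.sum_le_sum fun k _ => ?_
        rw [hfib2]
        refine Finset.sum_le_sum fun σ _ => ?_
        exact Finset.sum_le_sum_of_subset_of_nonneg (Finset.filter_subset _ _)
          fun σ' _ _ => hnn σ σ'

lemma exists_forall_mul_pow_le (m : ℕ) {x : ℝ} (h0 : 0 ≤ x) (h1 : x < 1) :
    ∃ C : ℝ, 0 < C ∧ ∀ n : ℕ, ((n : ℝ) + 1) ^ m * x ^ n ≤ C := by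
  have h := tendsto_pow_const_mul_const_pow_of_abs_lt_one m (by rwa [abs_of_nonneg h0] : |x| < 1)
  obtain ⟨C, hC⟩ := h.bddAbove_range
  have hb : ∀ n : ℕ, (n : ℝ) ^ m * x ^ n ≤ C := fun n => hC ⟨n, rfl⟩
  refine ⟨2 ^ m * |C| + 1, by positivity, fun n => ?_⟩
  rcases Nat.eq_zero_or_pos n with rfl | hn
  · norm_num
  · have h2 : ((n : ℝ) + 1) ^ m ≤ 2 ^ m * (n : ℝ) ^ m := by
      rw [← mul_pow]
      have : (1 : ℝ) ≤ n := by exact_mod_cast hn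
      gcongr
      linarith
    calc ((n : ℝ) + 1) ^ m * x ^ n ≤ 2 ^ m * (n : ℝ) ^ m * x ^ n := by gcongr
      _ = 2 ^ m * ((n : ℝ) ^ m * x ^ n) := by ring
      _ ≤ 2 ^ m * |C| := by
          gcongr
          exact (hb n).trans (le_abs_self C)
      _ ≤ _ := by linarith

/-- Giving up a little in the base, `r < ρ`, absorbs the polynomial number of types into a constant.
-/
lemma exists_mul_pow_le_affinity (φ : S ≃ S) {q q' : S → ℝ} (hq : ∀ s, 0 ≤ q s)
    (h1 : ∀ s, q (φ s) = q' s) (h2 : ∀ s, q' (φ s) = q s) {r : ℝ} (hr0 : 0 ≤ r)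
    (hr : r < ∑ s, √(q s * q' s)) :
    ∃ C : ℝ, 0 < C ∧ ∀ m : ℕ, C * r ^ m ≤ affinity q q' (Fin m) := by
  have hq' : ∀ s, 0 ≤ q' s := fun s => h1 s ▸ hq _
  set ρ := ∑ s, √(q s * q' s) with hρ
  have hρ0 : 0 < ρ := hr0.trans_lt hr
  have hA1 : 0 < affinity q q' Unit := by
    have hnn : ∀ σ : Unit → S, 0 ≤ min (∏ j, q (σ j)) (∏ j, q' (σ j)) := fun σ =>
      le_min (Finset.prod_nonneg fun _ _ => hq _) (Finset.prod_nonneg fun _ _ => hq' _)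
    obtain ⟨s, -, hs⟩ := Finset.exists_ne_zero_of_sum_ne_zero hρ0.ne'
    have hs' : 0 < q s * q' s := Real.sqrt_pos.1 (lt_of_le_of_ne (Real.sqrt_nonneg _) hs.symm)
    refine lt_of_lt_of_le ?_ (Finset.single_le_sum (fun σ _ => hnn σ)
      (Finset.mem_univ (fun _ : Unit => s)))
    simp only [Finset.univ_unique, Finset.prod_const, Finset.card_singleton, pow_one]
    exact lt_min (pos_of_mul_pos_left hs' (hq' s)) (pos_of_mul_pos_right hs' (hq s))
  obtain ⟨B, hB0, hB⟩ := exists_forall_mul_pow_le (Fintype.card S) (sq_nonneg (r / ρ))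
    (by rw [sq_lt_one_iff₀ (by positivity)]; exact (div_lt_one hρ0).2 hr)
  have heven : ∀ k : ℕ, B⁻¹ * r ^ (2 * k) ≤ affinity q q' (Fin k ⊕ Fin k) := by
    intro k
    have hk := sqrt_sum_pow_le_affinity φ hq h1 h2 (Fin k)
    rw [← hρ, Fintype.card_fin] at hk
    have hBk := hB k
    have hρk : (0 : ℝ) < ρ ^ (2 * k) := by positivity
    have hx : ((r / ρ) ^ 2) ^ k = r ^ (2 * k) / ρ ^ (2 * k) := by
      rw [← pow_mul, div_pow]
    rw [hx] at hBk
    have h3 : ((k : ℝ) + 1) ^ Fintype.card S * r ^ (2 * k) ≤ B * ρ ^ (2 * k) := by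
      rwa [← mul_div_assoc, div_le_iff₀ hρk] at hBk
    have h4 : (0 : ℝ) < ((k : ℝ) + 1) ^ Fintype.card S := by positivity
    rw [inv_mul_le_iff₀ hB0]
    refine le_of_mul_le_mul_left ?_ h4
    calc _ ≤ B * ρ ^ (2 * k) := h3
      _ ≤ B * _ := mul_le_mul_of_nonneg_left hk hB0.le
      _ = _ := by ring
  set A := affinity q q' Unit
  -- The second constant is for odd `m`, where one extra factor contributes the affinity `A`.
  -- Dividing by `r + 1` makes room for the surplus power of `r` without assuming `r ≤ 1`.
  refine ⟨min B⁻¹ (B⁻¹ * A / (r + 1)), by positivity, fun m => ?_⟩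
  rcases Nat.even_or_odd' m with ⟨k, rfl | rfl⟩
  · rw [affinity_congr q q' (κ := Fin k ⊕ Fin k) (Fintype.equivOfCardEq (by simp; ring))]
    refine (mul_le_mul_of_nonneg_right (min_le_left _ _) (by positivity)).trans (heven k)
  · rw [affinity_congr q q' (κ := (Fin k ⊕ Fin k) ⊕ Unit) (Fintype.equivOfCardEq (by simp; ring))]
    refine le_trans ?_ (affinity_mul_le hq hq' _ _)
    calc _ ≤ B⁻¹ * A / (r + 1) * r ^ (2 * k + 1) :=
          mul_le_mul_of_nonneg_right (min_le_right _ _) (by positivity)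
      _ = (B⁻¹ * r ^ (2 * k)) * A * (r / (r + 1)) := by ring
      _ ≤ (B⁻¹ * r ^ (2 * k)) * A * 1 := by
          gcongr
          rw [div_le_one (by positivity)]
          linarith
      _ ≤ _ := by
          rw [mul_one]
          exact mul_le_mul_of_nonneg_right (heven k) hA1.le

/-- Half of the affinity bounds the probability of the set where the weight `q'` dominates. -/
lemma half_affinity_le (φ : S ≃ S) {q q' : S → ℝ} (hq : ∀ s, 0 ≤ q s)
    (h1 : ∀ s, q (φ s) = q' s) (h2 : ∀ s, q' (φ s) = q s)
    (ι : Type*) [Fintype ι] [DecidableEq ι] :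
    affinity q q' ι / 2 ≤
      ∑ σ : ι → S with ∏ j, q (σ j) ≤ ∏ j, q' (σ j), ∏ j, q (σ j) := by
  let p : (ι → S) → ℝ := fun σ => ∏ j, q (σ j)
  let p' : (ι → S) → ℝ := fun σ => ∏ j, q' (σ j)
  -- By the symmetry `φ`, the two hypotheses contribute equally to the affinity away from ties, so
  -- one of them carries at least half of it.
  have hflip : (∑ σ : ι → S, if p' σ < p σ then p' σ else 0)
      = ∑ σ : ι → S, if p σ < p' σ then p σ else 0 := by
    rw [← (Equiv.arrowCongr (Equiv.refl ι) φ).sum_comp]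
    refine Finset.sum_congr rfl fun σ _ => ?_
    simp [p, p', h1, h2]
  have hsplit : affinity q q' ι =
      (∑ σ : ι → S, if p σ ≤ p' σ then p σ else 0) +
        ∑ σ : ι → S, if p' σ < p σ then p' σ else 0 := by
    unfold affinity
    rw [← Finset.sum_add_distrib]
    refine Finset.sum_congr rfl fun σ _ => ?_
    rcases le_or_gt (p σ) (p' σ) with h | h
    · rw [if_pos h, if_neg (not_lt.2 h), add_zero, min_eq_left h]
    · rw [if_neg (not_le.2 h), if_pos h, zero_add, min_eq_right h.le]
  have : (∑ σ : ι → S, if p σ < p' σ then p σ else 0)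
      ≤ ∑ σ : ι → S, if p σ ≤ p' σ then p σ else 0 := by
    refine Finset.sum_le_sum fun σ _ => ?_
    have hp : 0 ≤ p σ := Finset.prod_nonneg fun _ _ => hq _
    split_ifs with h h' h'
    exacts [le_rfl, absurd h.le h', hp, le_rfl]
  rw [Finset.sum_filter]
  change affinity q q' ι / 2 ≤ ∑ σ : ι → S, if p σ ≤ p' σ then p σ else 0
  linarith

end Affinity

/-! ### Grouping independent variables into independent blocks -/

lemma iIndepFun_curry {Ω ι : Type*} [MeasurableSpace Ω] {P : Measure Ω} {κ : ι → Type*}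
    {E : (i : ι) → κ i → Type*} [∀ i j, MeasurableSpace (E i j)]
    {Y : (i : ι) → (j : κ i) → Ω → E i j} (hm : ∀ i j, Measurable (Y i j))
    (h : iIndepFun (fun (p : (i : ι) × κ i) ω => Y p.1 p.2 ω) P) :
    iIndepFun (fun i ω => (Y i · ω)) P := by
  have := h.isProbabilityMeasure
  have : ∀ i j, IsProbabilityMeasure (P.map (Y i j)) :=
    fun i j => Measure.isProbabilityMeasure_map (hm i j).aemeasurable
  have h2 : ∀ i, iIndepFun (Y i) P := fun i =>
    h.precomp (g := fun j : κ i => (⟨i, j⟩ : (i : ι) × κ i)) sigma_mk_injective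
  have hcomp : (MeasurableEquiv.piCurry E) ∘ (fun ω p => Y p.1 p.2 ω) = fun ω i j => Y i j ω := by
    ext; simp [Sigma.curry]
  rw [iIndepFun_iff_map_fun_eq_infinitePi_map (by fun_prop)] at h ⊢
  rw [← hcomp, ← Measure.map_map (by fun_prop) (by fun_prop), h,
    Measure.infinitePi_map_piCurry (fun i j => P.map (Y i j))]
  congrm Measure.infinitePi fun i => ?_
  rw [(iIndepFun_iff_map_fun_eq_infinitePi_map (by fun_prop)).1 (h2 i)]

/-! ### Joint law and independence of the observations around nodes -/

section Marks

variable {Ω : Type*} [MeasurableSpace Ω] {P : Measure Ω} {d : ℕ} {lam : ℝ}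
  {X : ℕ → Ω → Space d} {Z : ℕ → Ω → ℤˣ} {U : Sym2 ℕ → Ω → ℝ}

/-- The labels and the edge variables as one family of real random variables. -/
def mark (Z : ℕ → Ω → ℤˣ) (U : Sym2 ℕ → Ω → ℝ) : ℕ ⊕ Pairs → Ω → ℝ
  | .inl i => fun ω => ((Z i ω : ℤ) : ℝ)
  | .inr e => U e

lemma IsMarkedPoissonProcess.measurable_mark (h : IsMarkedPoissonProcess P lam X Z U)
    (k : ℕ ⊕ Pairs) : Measurable (mark Z U k) := by
  cases k with
  | inl i => exact (Measurable.of_discrete (f := fun z : ℤˣ => ((z : ℤ) : ℝ))).comp (h.measurable_Z i)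
  | inr e => exact h.measurable_U e

lemma IsMarkedPoissonProcess.iIndepFun_mark (h : IsMarkedPoissonProcess P lam X Z U) :
    iIndepFun (mark Z U) P := by
  rw [iIndepFun_iff_measure_inter_preimage_eq_mul]
  intro S B hB
  have hcast : Measurable (fun z : ℤˣ => ((z : ℤ) : ℝ)) := .of_discrete
  have hset : (⋂ i ∈ S, mark Z U i ⁻¹' B i) =
      ((fun ω i => Z i ω) ⁻¹' {z | ∀ i ∈ S.toLeft, ((z i : ℤ) : ℝ) ∈ B (.inl i)}) ∩
      ((fun ω (e : Pairs) => U e ω) ⁻¹' {u | ∀ e ∈ S.toRight, u e ∈ B (.inr e)}) := by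
    ext ω
    simp [mark]
  have hL : MeasurableSet {z : ℕ → ℤˣ | ∀ i ∈ S.toLeft, ((z i : ℤ) : ℝ) ∈ B (.inl i)} := by
    simp only [Set.ofPred_forall]
    exact Finset.measurableSet_biInter _ fun i hi =>
      (hcast.comp (measurable_pi_apply i)) (hB _ (Finset.mem_toLeft.1 hi))
  have hR : MeasurableSet {u : Pairs → ℝ | ∀ e ∈ S.toRight, u e ∈ B (.inr e)} := by
    simp only [Set.ofPred_forall]
    exact Finset.measurableSet_biInter _ fun i hi =>
      (measurable_pi_apply i) (hB _ (Finset.mem_toRight.1 hi))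
  rw [hset, h.indep_Z_U.measure_inter_preimage_eq_mul _ _ hL hR]
  have e1 : P ((fun ω i => Z i ω) ⁻¹' {z | ∀ i ∈ S.toLeft, ((z i : ℤ) : ℝ) ∈ B (.inl i)})
      = ∏ i ∈ S.toLeft, P (mark Z U (.inl i) ⁻¹' B (.inl i)) := by
    have := (iIndepFun_iff_measure_inter_preimage_eq_mul.1 h.indep_Z) S.toLeft
      (sets := fun i => (fun z : ℤˣ => ((z : ℤ) : ℝ)) ⁻¹' B (.inl i))
      (fun i hi => hcast (hB _ (Finset.mem_toLeft.1 hi)))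
    convert! this using 2
    ext ω
    simp
  have e2 : P ((fun ω (e : Pairs) => U e ω) ⁻¹' {u | ∀ e ∈ S.toRight, u e ∈ B (.inr e)})
      = ∏ e ∈ S.toRight, P (mark Z U (.inr e) ⁻¹' B (.inr e)) := by
    have := (iIndepFun_iff_measure_inter_preimage_eq_mul.1 h.indep_U) S.toRight
      (sets := fun e => B (.inr e))
      (fun i hi => (hB _ (Finset.mem_toRight.1 hi)))
    convert! this using 2
    ext ω
    simp
  rw [e1, e2]
  conv_rhs => rw [← Finset.toLeft_disjSum_toRight (u := S), Finset.prod_disjSum]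

lemma IsMarkedPoissonProcess.law_marks (h : IsMarkedPoissonProcess P lam X Z U)
    {α β : Type*} [Fintype α] [Fintype β] {f : α → ℕ} (hf : f.Injective) {e : β → Pairs}
    (he : e.Injective) (z : α → ℤˣ) {B : β → Set ℝ} (hB : ∀ b, MeasurableSet (B b)) :
    P.real {ω | (∀ a, Z (f a) ω = z a) ∧ ∀ b, U (e b) ω ∈ B b} =
      (1 / 2) ^ Fintype.card α * ∏ b, P.real {ω | U (e b) ω ∈ B b} := by
  have hset : {ω | (∀ a, Z (f a) ω = z a) ∧ ∀ b, U (e b) ω ∈ B b} =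
      ((fun ω i => Z i ω) ⁻¹' {y | ∀ a, y (f a) = z a}) ∩
      ((fun ω (e : Pairs) => U e ω) ⁻¹' {u | ∀ b, u (e b) ∈ B b}) := rfl
  have hL : MeasurableSet {y : ℕ → ℤˣ | ∀ a, y (f a) = z a} := by
    simp only [Set.ofPred_forall]
    exact MeasurableSet.iInter fun a =>
      measurableSet_eq_fun (measurable_pi_apply (f a)) measurable_const
  have hR : MeasurableSet {u : Pairs → ℝ | ∀ b, u (e b) ∈ B b} := by
    simp only [Set.ofPred_forall]
    exact MeasurableSet.iInter fun b => (measurable_pi_apply (e b)) (hB b)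
  have e1 : P ((fun ω i => Z i ω) ⁻¹' {y | ∀ a, y (f a) = z a}) = (1 / 2) ^ Fintype.card α := by
    have := (h.indep_Z.precomp hf).meas_iInter (s := fun a => {ω | Z (f a) ω = z a})
      (fun a => ⟨{z a}, MeasurableSet.of_discrete, rfl⟩)
    simp only [h.law_Z, Finset.prod_const, Finset.card_univ] at this
    rw [← this]
    congr 1
    ext ω
    simp
  have e2 : P ((fun ω (e : Pairs) => U e ω) ⁻¹' {u | ∀ b, u (e b) ∈ B b}) =
      ∏ b, P {ω | U (e b) ω ∈ B b} := by
    have := (h.indep_U.precomp he).meas_iInter (s := fun b => {ω | U (e b) ω ∈ B b})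
      (fun b => ⟨B b, hB b, rfl⟩)
    rw [← this]
    congr 1
    ext ω
    simp
  rw [hset, measureReal_def, h.indep_Z_U.measure_inter_preimage_eq_mul _ _ hL hR, e1, e2,
    ENNReal.toReal_mul, ENNReal.toReal_prod]
  simp [measureReal_def]

lemma IsMarkedPoissonProcess.real_U_le (h : IsMarkedPoissonProcess P lam X Z U) (e : Pairs)
    {c : ℝ} (h0 : 0 ≤ c) (h1 : c ≤ 1) : P.real {ω | U e ω ∈ Set.Iic c} = c := by
  rw [(h.law_U e).measureReal_eq (p := (· ∈ Set.Iic c)) measurableSet_Iic, Set.ofPred_mem_eq,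
    measureReal_restrict_apply measurableSet_Iic]
  have : Set.Iic c ∩ Set.Icc 0 1 = Set.Icc 0 c := by
    ext x; simp; constructor
    · rintro ⟨h1, h2, h3⟩; exact ⟨h2, h1⟩
    · rintro ⟨h2, h3⟩; exact ⟨h3, h2, h3.trans h1⟩
  rw [this]
  simp [h0]

lemma IsMarkedPoissonProcess.real_U_gt [IsProbabilityMeasure P]
    (h : IsMarkedPoissonProcess P lam X Z U) (e : Pairs)
    {c : ℝ} (h0 : 0 ≤ c) (h1 : c ≤ 1) : P.real {ω | U e ω ∈ Set.Ioi c} = 1 - c := by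
  have := probReal_compl_eq_one_sub (μ := P) (h.measurable_U e (measurableSet_Iic (a := c)))
  rw [← Set.compl_Iic]
  exact this.trans (congrArg (1 - ·) (h.real_U_le e h0 h1))

/-- The probability of a pair (product of two labels, presence of an edge), up to the factor
`1 / 2`. -/
noncomputable def edgeWeight (a b : ℝ) (s : ℤˣ × Bool) : ℝ :=
  if s.2 then (if s.1 = 1 then a else b) else 1 - if s.1 = 1 then a else b

/-- The set of values of the edge variable that lead to the given presence of an edge. -/
noncomputable def edgeSet (a b : ℝ) (s : ℤˣ × Bool) : Set ℝ :=
  if s.2 then Set.Iic (if s.1 = 1 then a else b) else Set.Ioi (if s.1 = 1 then a else b)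

lemma measurableSet_edgeSet (a b : ℝ) (s : ℤˣ × Bool) : MeasurableSet (edgeSet a b s) := by
  unfold edgeSet
  split_ifs <;> measurability

lemma IsMarkedPoissonProcess.real_edgeSet [IsProbabilityMeasure P]
    (h : IsMarkedPoissonProcess P lam X Z U) (e : Pairs) {a b : ℝ} (hb : 0 ≤ b) (hba : b < a)
    (ha : a ≤ 1) (s : ℤˣ × Bool) :
    P.real {ω | U e ω ∈ edgeSet a b s} = edgeWeight a b s := by
  have h0 : 0 ≤ (if s.1 = 1 then a else b) := by split_ifs <;> linarith
  have h1 : (if s.1 = 1 then a else b) ≤ 1 := by split_ifs <;> linarith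
  unfold edgeSet edgeWeight
  cases s.2
  · simpa using h.real_U_gt e h0 h1
  · simpa using h.real_U_le e h0 h1

lemma edgeWeight_nonneg {a b : ℝ} (hb : 0 ≤ b) (hba : b < a) (ha : a ≤ 1) (s : ℤˣ × Bool) :
    0 ≤ edgeWeight a b s := by
  unfold edgeWeight
  split_ifs <;> linarith

/-- The labels and edges seen from the node `c` with potential neighbours `nb j`. -/
noncomputable def star (Z : ℕ → Ω → ℤˣ) (U : Sym2 ℕ → Ω → ℝ) (a b : ℝ) {J : Type*} (c : ℕ) (nb : J → ℕ)
    (ω : Ω) (j : J) : ℤˣ × Bool :=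
  (Z c ω * Z (nb j) ω, decide (U s(c, nb j) ω ≤ if Z c ω = Z (nb j) ω then a else b))

/-- The labels of the neighbours relative to the centre are again independent and uniform, whatever
the label of the centre. This gives a product law with a factor one half for each neighbour. -/
lemma IsMarkedPoissonProcess.law_star [IsProbabilityMeasure P]
    (h : IsMarkedPoissonProcess P lam X Z U) {a b : ℝ} (hb : 0 ≤ b) (hba : b < a) (ha : a ≤ 1)
    {J : Type*} [Fintype J] {c : ℕ} {nb : J → ℕ} (hnb : nb.Injective) (hc : ∀ j, nb j ≠ c)
    (s : J → ℤˣ × Bool) :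
    P.real {ω | star Z U a b c nb ω = s} = ∏ j, edgeWeight a b (s j) / 2 := by
  let e : J → Pairs := fun j => ⟨s(c, nb j), by simpa using (hc j).symm⟩
  let f : Option J → ℕ := fun o => o.elim c nb
  have hf : f.Injective := by
    rintro (_ | i) (_ | j) hij
    · rfl
    · exact absurd hij.symm (hc j)
    · exact absurd hij (hc i)
    · exact congrArg some (hnb hij)
  have he : e.Injective := by
    intro i j hij
    have : s(c, nb i) = s(c, nb j) := congrArg Subtype.val hij
    exact hnb (Sym2.congr_right.1 this)
  let E : ℤˣ → Set Ω := fun t =>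
    {ω | (∀ o, Z (f o) ω = o.elim t fun j => t * (s j).1) ∧ ∀ j, U (e j) ω ∈ edgeSet a b (s j)}
  have hE : ∀ t, P.real (E t) = (1 / 2) * ∏ j, edgeWeight a b (s j) / 2 := by
    intro t
    rw [show P.real (E t) = _ from h.law_marks hf he (fun o => o.elim t fun j => t * (s j).1)
      fun j => measurableSet_edgeSet a b (s j)]
    simp only [h.real_edgeSet _ hb hba ha, Fintype.card_option, Finset.prod_div_distrib,
      Finset.prod_const, Finset.card_univ]
    rw [pow_succ, one_div_pow]
    field_simp
  -- Once the label of the centre is fixed, the relative labels determine all labels and hence the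
  -- threshold for each edge variable.
  have hset : {ω | star Z U a b c nb ω = s} = E 1 ∪ E (-1) := by
    have hmem : ∀ ω, star Z U a b c nb ω = s ↔ ω ∈ E (Z c ω) := by
      intro ω
      have hif : ∀ x y : ℤˣ, (x = y) ↔ x * y = 1 := by decide
      have hmul : ∀ x y w : ℤˣ, x * y = w ↔ y = x * w := by decide
      simp only [E, f, e, Set.mem_ofPred_eq, Option.forall, Option.elim, true_and, funext_iff, star,
        Prod.ext_iff, ← forall_and]
      refine forall_congr' fun j => ?_
      rw [hmul, and_congr_right_iff]
      intro hj
      have : (Z c ω = Z (nb j) ω) ↔ (s j).1 = 1 := by rw [hif, hj, ← mul_assoc]; simp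
      unfold edgeSet
      simp only [this]
      cases (s j).2 <;> simp
    ext ω
    constructor
    · intro hω
      have := (hmem ω).1 hω
      rcases Int.units_eq_one_or (Z c ω) with h1 | h1 <;> rw [h1] at this
      exacts [Or.inl this, Or.inr this]
    · have hZ : ∀ t, ω ∈ E t → Z c ω = t := fun t ht => ht.1 none
      rintro (hω | hω)
      all_goals exact (hmem ω).2 (by rwa [hZ _ hω])
  have hmeas : MeasurableSet (E (-1)) := by
    have : E (-1) = (⋂ o, {ω | Z (f o) ω = Option.elim o (-1) fun j => -1 * (s j).1}) ∩
        ⋂ j, {ω | U (e j) ω ∈ edgeSet a b (s j)} := by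
      ext ω
      simp [E]
    rw [this]
    exact (MeasurableSet.iInter fun o => measurableSet_eq_fun (h.measurable_Z _)
      measurable_const).inter
      (MeasurableSet.iInter fun j => h.measurable_U _ (measurableSet_edgeSet _ _ _))
  rw [hset, measureReal_union ?_ hmeas, hE, hE]
  · ring
  · rw [Set.disjoint_left]
    intro ω h1 h2
    have h3 : (1 : ℤˣ) = -1 := (h1.1 none).symm.trans (h2.1 none)
    revert h3
    decide

/-- When all centres and neighbours are different nodes, the stars are functions of disjoint blocks
of the independent marks. -/
lemma IsMarkedPoissonProcess.iIndepFun_star (h : IsMarkedPoissonProcess P lam X Z U) (a b : ℝ)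
    {I : Type*} {J : I → Type*} [∀ i, Fintype (J i)] {c : I → ℕ} {nb : (i : I) → J i → ℕ}
    (hinj : Function.Injective (Sum.elim c (fun p : (i : I) × J i => nb p.1 p.2))) :
    iIndepFun (fun i => star Z U a b (c i) (nb i)) P := by
  have hne : ∀ i i' (j : J i), c i' ≠ nb i j := fun i i' j hij => by
    simpa using @hinj (.inl i') (.inr ⟨i, j⟩) hij
  let e : (i : I) → J i → Pairs := fun i j => ⟨s(c i, nb i j), by simpa using hne _ _ _⟩
  let g : (i : I) → (Option (J i) ⊕ J i) → ℕ ⊕ Pairs := fun i k =>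
    k.elim (fun o => .inl (o.elim (c i) (nb i))) (fun j => .inr (e i j))
  have hg : Function.Injective (fun p : (i : I) × (Option (J i) ⊕ J i) => g p.1 p.2) := by
    have hc : ∀ i i', c i = c i' → i = i' := fun i i' hi => by
      simpa using @hinj (.inl i) (.inl i') hi
    have hn : ∀ i i' j j', nb i j = nb i' j' → (⟨i, j⟩ : (i : I) × J i) = ⟨i', j'⟩ :=
      fun i i' j j' hi => by
        simpa only [Sum.inr.injEq] using @hinj (.inr ⟨i, j⟩) (.inr ⟨i', j'⟩) hi
    rintro ⟨i, (_ | j) | j⟩ ⟨i', (_ | j') | j'⟩ hij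
    all_goals simp only [g, e, Sum.elim_inl, Sum.elim_inr, Option.elim, Sum.inl.injEq,
      Sum.inr.injEq, reduceCtorEq, Subtype.mk.injEq] at hij
    · obtain rfl := hc _ _ hij
      rfl
    · exact absurd hij (hne _ _ _)
    · exact absurd hij.symm (hne _ _ _)
    · cases hn _ _ _ _ hij
      rfl
    · rw [Sym2.eq_iff] at hij
      rcases hij with ⟨-, h2⟩ | ⟨h1, -⟩
      · cases hn _ _ _ _ h2
        rfl
      · exact absurd h1 (hne _ _ _)
  have hind := iIndepFun_curry (Y := fun i k => mark Z U (g i k)) (fun i k => h.measurable_mark _)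
    (h.iIndepFun_mark.precomp hg)
  -- This recovers the labels from their encoding as real numbers in `mark`.
  let sgn : ℝ → ℤˣ := fun x => if 0 < x then 1 else -1
  have hsgn : Measurable sgn := Measurable.ite measurableSet_Ioi measurable_const measurable_const
  have hsgnZ : ∀ z : ℤˣ, sgn ((z : ℤ) : ℝ) = z := by
    intro z
    rcases Int.units_eq_one_or z with rfl | rfl <;> norm_num [sgn]
  let φ : (i : I) → ((Option (J i) ⊕ J i) → ℝ) → (J i → ℤˣ × Bool) := fun i y j =>
    (sgn (y (.inl none)) * sgn (y (.inl (some j))),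
      decide (y (.inr j) ≤ if sgn (y (.inl none)) = sgn (y (.inl (some j))) then a else b))
  have hφ : ∀ i, Measurable (φ i) := by
    intro i
    refine measurable_pi_lambda _ fun j => Measurable.prodMk ?_ ?_
    · have h1 : Measurable fun y : (Option (J i) ⊕ J i) → ℝ => sgn (y (.inl none)) :=
        hsgn.comp (measurable_pi_apply _)
      have h2 : Measurable fun y : (Option (J i) ⊕ J i) → ℝ => sgn (y (.inl (some j))) :=
        hsgn.comp (measurable_pi_apply _)
      exact (measurable_of_countable (fun p : ℤˣ × ℤˣ => p.1 * p.2)).comp (h1.prodMk h2)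
    · have h1 : Measurable fun y : (Option (J i) ⊕ J i) → ℝ => sgn (y (.inl none)) :=
        hsgn.comp (measurable_pi_apply _)
      have h2 : Measurable fun y : (Option (J i) ⊕ J i) → ℝ => sgn (y (.inl (some j))) :=
        hsgn.comp (measurable_pi_apply _)
      have h3 := (measurable_of_countable (fun p : ℤˣ × ℤˣ => if p.1 = p.2 then a else b)).comp
        (h1.prodMk h2)
      refine measurable_to_bool ?_
      have : (fun y : (Option (J i) ⊕ J i) → ℝ => decide (y (.inr j) ≤
        if sgn (y (.inl none)) = sgn (y (.inl (some j))) then a else b)) ⁻¹' {true} =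
        {y | y (.inr j) ≤ if sgn (y (.inl none)) = sgn (y (.inl (some j))) then a else b} := by
        ext y; simp
      rw [this]
      exact measurableSet_le (measurable_pi_apply _) h3
  have := hind.comp φ hφ
  convert! this using 2 with i
  ext ω j : 2
  simp [star, φ, g, e, mark, hsgnZ]

end Marks

/-! ### Ambiguous observations and their exponential rate -/

/-- Reversal of the relative label. -/
def relabel : ℤˣ × Bool ≃ ℤˣ × Bool := (Equiv.neg ℤˣ).prodCongr (Equiv.refl Bool)

lemma relabel_relabel (s : ℤˣ × Bool) : relabel (relabel s) = s := by
  obtain ⟨z, e⟩ := s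
  simp [relabel]

/-- The observations from a node that are at least as likely under the opposite label. -/
def ambiguous (a b : ℝ) (J : Type*) [Fintype J] : Set (J → ℤˣ × Bool) :=
  {σ | ∏ j, edgeWeight a b (σ j) ≤ ∏ j, edgeWeight a b (relabel (σ j))}

lemma sum_sqrt_edgeWeight {a b : ℝ} (hb : 0 ≤ b) (hba : b < a) (ha : a ≤ 1) :
    ∑ s, √(edgeWeight a b s / 2 * (edgeWeight a b (relabel s) / 2)) =
      √(a * b) + √((1 - a) * (1 - b)) := by
  have h2 : ∀ x y : ℝ, 0 ≤ x → 0 ≤ y → √(x / 2 * (y / 2)) = √(x * y) / 2 := by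
    intro x y hx hy
    rw [show x / 2 * (y / 2) = x * y / 2 ^ 2 by ring, Real.sqrt_div (mul_nonneg hx hy),
      Real.sqrt_sq (by norm_num)]
  have hneg : (-1 : ℤˣ) ≠ 1 := by decide
  have huniv : (Finset.univ : Finset ℤˣ) = {1, -1} := rfl
  simp only [h2 _ _ (edgeWeight_nonneg hb hba ha _) (edgeWeight_nonneg hb hba ha _)]
  rw [Fintype.sum_prod_type, huniv, Finset.sum_insert (by simp)]
  simp [edgeWeight, relabel, hneg]
  rw [mul_comm b a, mul_comm (1 - b)]
  ring

/-- The strict inequality in `hκ` survives a small decrease of the Bhattacharyya coefficient `ρ` to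
`r`, and the affinity bound holds for every such `r`. The sum in the conclusion is the probability
that a node with neighbours `J` is ambiguous. -/
lemma exists_rate {a b : ℝ} (hb : 0 ≤ b) (hba : b < a) (ha : a ≤ 1) {κ : ℝ}
    (hκ : κ * (1 - √(a * b) - √((1 - a) * (1 - b))) < 1) :
    ∃ r C : ℝ, 0 ≤ r ∧ r ≤ 1 ∧ 0 < C ∧ C ≤ 1 ∧ κ * (1 - r) < 1 ∧
      ∀ (J : Type) [Fintype J] [DecidableEq J], ∀ A : Finset (J → ℤˣ × Bool),
        (∀ σ, σ ∈ A ↔ σ ∈ ambiguous a b J) →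
        C * r ^ Fintype.card J ≤ ∑ σ ∈ A, ∏ j, edgeWeight a b (σ j) / 2 := by
  set ρ := √(a * b) + √((1 - a) * (1 - b)) with hρ
  have hρ0 : 0 ≤ ρ := by positivity
  have hρ1 : ρ ≤ 1 := by
    have h1 : √(a * b) ≤ (a + b) / 2 := by
      rw [Real.sqrt_le_left (by linarith)]; nlinarith [sq_nonneg (a - b)]
    have h2 : √((1 - a) * (1 - b)) ≤ ((1 - a) + (1 - b)) / 2 := by
      rw [Real.sqrt_le_left (by linarith)]; nlinarith [sq_nonneg (a - b)]
    linarith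
  let q : ℤˣ × Bool → ℝ := fun s => edgeWeight a b s / 2
  let q' : ℤˣ × Bool → ℝ := fun s => edgeWeight a b (relabel s) / 2
  have hq : ∀ s, 0 ≤ q s := fun s => div_nonneg (edgeWeight_nonneg hb hba ha s) (by norm_num)
  have hq' : ∀ s, 0 ≤ q' s := fun s => div_nonneg (edgeWeight_nonneg hb hba ha _) (by norm_num)
  have h1 : ∀ s, q (relabel s) = q' s := fun s => rfl
  have h2 : ∀ s, q' (relabel s) = q s := fun s => by simp only [q', q, relabel_relabel]
  have hsum : ∑ s, √(q s * q' s) = ρ := sum_sqrt_edgeWeight hb hba ha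
  have hzero : affinity q q' (Fin 0) = 1 := by simp [affinity]
  have hκ' : κ * (1 - ρ) < 1 := by rw [hρ]; convert! hκ using 2; ring
  suffices h : ∃ r C : ℝ, 0 ≤ r ∧ r ≤ 1 ∧ 0 < C ∧ κ * (1 - r) < 1 ∧
      ∀ m : ℕ, C * r ^ m ≤ affinity q q' (Fin m) by
    obtain ⟨r, C, hr0, hr1, hC, hκr, hm⟩ := h
    -- The bound at `m = 0`, where the affinity is one.
    have hC1 : C ≤ 1 := by simpa [hzero] using hm 0
    refine ⟨r, C / 2, hr0, hr1, by positivity, by linarith, hκr, fun J _ _ A hA => ?_⟩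
    have h3 := half_affinity_le relabel hq h1 h2 J
    rw [affinity_congr q q' (Fintype.equivFin J)] at h3
    calc C / 2 * r ^ Fintype.card J = C * r ^ Fintype.card J / 2 := by ring
      _ ≤ _ := (div_le_div_of_nonneg_right (hm _) (by norm_num)).trans h3
      _ = _ := by
        refine Finset.sum_congr ?_ fun _ _ => rfl
        ext σ
        simp only [Finset.mem_filter, Finset.mem_univ, true_and, hA, ambiguous, q, q',
          Finset.prod_div_distrib, Finset.prod_const, Finset.card_univ]
        exact div_le_div_iff_of_pos_right (by positivity)
  rcases hρ0.eq_or_lt with h0 | h0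
  -- If `ρ = 0` there is no smaller nonnegative `r`. With `r = 0` and `0 ^ 0 = 1`, the bound only
  -- says that isolated nodes are ambiguous.
  · refine ⟨0, 1, le_rfl, zero_le_one, one_pos, by rwa [h0], fun m => ?_⟩
    rcases Nat.eq_zero_or_pos m with rfl | hmpos
    · simp [hzero]
    · rw [zero_pow hmpos.ne', mul_zero]
      exact Finset.sum_nonneg fun σ _ => le_min (Finset.prod_nonneg fun _ _ => hq _)
        (Finset.prod_nonneg fun _ _ => hq' _)
  · have hev : ∀ᶠ r in 𝓝[<] ρ, κ * (1 - r) < 1 := by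
      have : Tendsto (fun r : ℝ => κ * (1 - r)) (𝓝[<] ρ) (𝓝 (κ * (1 - ρ))) :=
        (Continuous.tendsto (by fun_prop) ρ).mono_left nhdsWithin_le_nhds
      exact this.eventually_lt_const hκ'
    obtain ⟨r, hr, hr0, hrρ⟩ := (hev.and (Ioo_mem_nhdsLT h0)).exists
    obtain ⟨C, hC, hm⟩ := exists_mul_pow_le_affinity relabel hq h1 h2 hr0.le
      (hrρ.trans_eq hsum.symm)
    exact ⟨r, C, hr0.le, (hrρ.trans_le hρ1).le, hC, hr, hm⟩

/-! ### The probability that no star of a disjoint family is ambiguous -/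

section Marks

variable {Ω : Type*} [MeasurableSpace Ω] {P : Measure Ω} {d : ℕ} {lam : ℝ}
  {X : ℕ → Ω → Space d} {Z : ℕ → Ω → ℤˣ} {U : Sym2 ℕ → Ω → ℝ}

lemma measureReal_eq_sum [IsFiniteMeasure P] {β : Type*} [Fintype β] {V : Ω → β}
    (hV : ∀ y, MeasurableSet {ω | V ω = y}) (A : Finset β) :
    P.real {ω | V ω ∈ A} = ∑ y ∈ A, P.real {ω | V ω = y} := by
  have : {ω | V ω ∈ A} = ⋃ y ∈ A, {ω | V ω = y} := by
    ext ω
    simp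
  rw [this, measureReal_biUnion_finset]
  · intro y _ y' _ hne
    rw [Function.onFun, Set.disjoint_left]
    exact fun ω h1 h2 => hne (h1.symm.trans h2)
  · exact fun y _ => hV y

lemma IsMarkedPoissonProcess.real_forall_star_notMem_le [IsProbabilityMeasure P]
    (h : IsMarkedPoissonProcess P lam X Z U) {a b : ℝ} (hb : 0 ≤ b) (hba : b < a) (ha : a ≤ 1)
    {r C : ℝ}
    (hrC : ∀ (J : Type) [Fintype J] [DecidableEq J], ∀ A : Finset (J → ℤˣ × Bool),
        (∀ σ, σ ∈ A ↔ σ ∈ ambiguous a b J) →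
        C * r ^ Fintype.card J ≤ ∑ σ ∈ A, ∏ j, edgeWeight a b (σ j) / 2)
    {I : Type*} [Fintype I] {J : I → Type} [∀ i, Fintype (J i)] {c : I → ℕ}
    {nb : (i : I) → J i → ℕ}
    (hinj : Function.Injective (Sum.elim c (fun p : (i : I) × J i => nb p.1 p.2))) :
    P.real {ω | ∀ i, star Z U a b (c i) (nb i) ω ∉ ambiguous a b (J i)} ≤
      ∏ i, (1 - C * r ^ Fintype.card (J i)) := by
  classical
  have hind := h.iIndepFun_star a b hinj
  have h1 := hind.meas_iInter
    (s := fun i => {ω | star Z U a b (c i) (nb i) ω ∉ ambiguous a b (J i)})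
    (fun i => ⟨(ambiguous a b (J i))ᶜ, MeasurableSet.of_discrete, rfl⟩)
  rw [Set.ofPred_forall, measureReal_def, h1, ENNReal.toReal_prod]
  refine Finset.prod_le_prod (fun _ _ => ENNReal.toReal_nonneg) fun i _ => ?_
  have hmeas : ∀ s, MeasurableSet {ω | star Z U a b (c i) (nb i) ω = s} := by
    intro s
    have hm : Measurable (star Z U a b (c i) (nb i)) := by
      refine measurable_pi_lambda _ fun j => Measurable.prodMk ?_ ?_
      · exact (Measurable.of_discrete (f := fun p : ℤˣ × ℤˣ => p.1 * p.2)).comp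
          ((h.measurable_Z _).prodMk (h.measurable_Z _))
      · refine measurable_to_bool ?_
        have : (fun ω => decide (U s(c i, nb i j) ω ≤ if Z (c i) ω = Z (nb i j) ω then a else b))
            ⁻¹' {true} = {ω | U s(c i, nb i j) ω ≤ if Z (c i) ω = Z (nb i j) ω then a else b} := by
          ext; simp
        rw [this]
        exact measurableSet_le (h.measurable_U _)
          ((Measurable.of_discrete (f := fun p : ℤˣ × ℤˣ => if p.1 = p.2 then a else b)).comp
          ((h.measurable_Z _).prodMk (h.measurable_Z _)))
    exact hm (measurableSet_singleton s)
  set A : Finset (J i → ℤˣ × Bool) := Finset.univ.filter (· ∈ ambiguous a b (J i)) with hA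
  have h2 := measureReal_eq_sum (P := P) hmeas A
  have hmA : MeasurableSet {ω | star Z U a b (c i) (nb i) ω ∈ A} := by
    have : {ω | star Z U a b (c i) (nb i) ω ∈ A} =
        ⋃ s ∈ A, {ω | star Z U a b (c i) (nb i) ω = s} := by
      ext; simp
    rw [this]
    exact Finset.measurableSet_biUnion _ fun s _ => hmeas s
  have h3 := probReal_compl_eq_one_sub (μ := P) hmA
  have hset : {ω | star Z U a b (c i) (nb i) ω ∉ ambiguous a b (J i)} =
      {ω | star Z U a b (c i) (nb i) ω ∈ A}ᶜ := by
    ext; simp [hA]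
  rw [← measureReal_def, hset, h3, h2]
  have h4 := hrC (J i) A (by simp [hA])
  have hnb : (nb i).Injective := by
    intro j j' hj
    simpa using @hinj (.inr ⟨i, j⟩) (.inr ⟨i, j'⟩) hj
  have hc : ∀ j, nb i j ≠ c i := fun j hj => by
    simpa using @hinj (.inr ⟨i, j⟩) (.inl i) hj
  simp only [h.law_star hb hba ha hnb hc]
  linarith

end Marks

/-! ### Likelihoods, reversal of one label, and the counting bound for estimators -/

section Likelihood

variable {N : ℕ}

open Classical in
/-- The probability of an edge at `e`, given the labels `z`, if only the pairs adjacent in `v` may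
be joined. -/
noncomputable def edgeProb (a b : ℝ) (v : SimpleGraph (Fin N)) (z : Fin N → ℤˣ)
    (e : Sym2 (Fin N)) : ℝ :=
  if e ∈ v.edgeSet then (if ∀ x ∈ e, ∀ y ∈ e, z x = z y then a else b) else 0

open Classical in
/-- The probability of the presence or absence of the edge `e` as in `g`, given the labels `z`. -/
noncomputable def edgeLik (a b : ℝ) (v g : SimpleGraph (Fin N)) (z : Fin N → ℤˣ)
    (e : Sym2 (Fin N)) : ℝ :=
  if e ∈ g.edgeSet then edgeProb a b v z e else 1 - edgeProb a b v z e

open Classical in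
/-- The probability of the graph `g`, given the labels `z`. -/
noncomputable def likelihood (a b : ℝ) (v g : SimpleGraph (Fin N)) (z : Fin N → ℤˣ) : ℝ :=
  ∏ e : Sym2 (Fin N) with ¬ e.IsDiag, edgeLik a b v g z e

open Classical in
/-- The observations of the node `i` from its potential neighbours. -/
noncomputable def localView (v g : SimpleGraph (Fin N)) (z : Fin N → ℤˣ) (i : Fin N)
    (j : v.neighborSet i) : ℤˣ × Bool :=
  (z i * z j, decide (g.Adj i j))

lemma edgeProb_mem {a b : ℝ} (hb : 0 ≤ b) (hba : b < a) (ha : a ≤ 1) (v : SimpleGraph (Fin N))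
    (z : Fin N → ℤˣ) (e : Sym2 (Fin N)) : edgeProb a b v z e ∈ Set.Icc 0 1 := by
  unfold edgeProb
  constructor <;> split_ifs <;> linarith

lemma edgeLik_nonneg {a b : ℝ} (hb : 0 ≤ b) (hba : b < a) (ha : a ≤ 1) (v g : SimpleGraph (Fin N))
    (z : Fin N → ℤˣ) (e : Sym2 (Fin N)) : 0 ≤ edgeLik a b v g z e := by
  have := edgeProb_mem hb hba ha v z e
  unfold edgeLik
  split_ifs
  exacts [this.1, sub_nonneg.2 this.2]

lemma edgeLik_congr (a b : ℝ) (v g : SimpleGraph (Fin N)) {z z' : Fin N → ℤˣ}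
    {e : Sym2 (Fin N)} (h : ∀ x ∈ e, z x = z' x) : edgeLik a b v g z e = edgeLik a b v g z' e := by
  have : (∀ x ∈ e, ∀ y ∈ e, z x = z y) ↔ ∀ x ∈ e, ∀ y ∈ e, z' x = z' y :=
    forall₂_congr fun x hx => forall₂_congr fun y hy => by rw [h x hx, h y hy]
  simp only [edgeLik, edgeProb, this]

lemma edgeLik_of_adj (a b : ℝ) {v g : SimpleGraph (Fin N)} (z : Fin N → ℤˣ)
    {i j : Fin N} (h : v.Adj i j) :
    edgeLik a b v g z s(i, j) = edgeWeight a b (localView v g z i ⟨j, h⟩) := by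
  have h1 : (∀ x ∈ s(i, j), ∀ y ∈ s(i, j), z x = z y) ↔ z i * z j = 1 := by
    have hif : ∀ x y : ℤˣ, (x = y) ↔ x * y = 1 := by decide
    rw [← hif]
    simp only [Sym2.mem_iff]
    constructor
    · exact fun h => h i (Or.inl rfl) j (Or.inr rfl)
    · rintro h x (rfl | rfl) y (rfl | rfl) <;> simp [h]
  simp only [edgeLik, edgeProb, edgeWeight, localView, SimpleGraph.mem_edgeSet, h, if_true, h1]
  by_cases hg : g.Adj i j <;> simp [hg] <;> congr

lemma edgeLik_of_not_adj (a b : ℝ) {v : SimpleGraph (Fin N)} (g : SimpleGraph (Fin N))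
    (z z' : Fin N → ℤˣ) {i j : Fin N} (h : ¬ v.Adj i j) :
    edgeLik a b v g z s(i, j) = edgeLik a b v g z' s(i, j) := by
  simp [edgeLik, edgeProb, h]

/-- Reversing the label of `i` affects only the factors of visible pairs containing `i`, and acts on
them by `relabel`. Ambiguity compares precisely the two products of these factors. -/
lemma likelihood_le_update {a b : ℝ} (hb : 0 ≤ b) (hba : b < a) (ha : a ≤ 1)
    {v g : SimpleGraph (Fin N)} {z : Fin N → ℤˣ} {i : Fin N} [Fintype (v.neighborSet i)]
    (h : localView v g z i ∈ ambiguous a b (v.neighborSet i)) :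
    likelihood a b v g z ≤ likelihood a b v g (Function.update z i (-z i)) := by
  classical
  set z' := Function.update z i (-z i) with hz'
  have hview : ∀ j, localView v g z' i j = relabel (localView v g z i j) := by
    intro j
    have hj : (j : Fin N) ≠ i := fun hj => v.loopless.irrefl i (by simpa [hj] using j.2)
    simp [localView, relabel, hz', Function.update_of_ne hj]
  have hstar : ∀ y : Fin N → ℤˣ, ∏ e : Sym2 (Fin N) with ¬ e.IsDiag ∧ i ∈ e, edgeLik a b v g y e =
      (∏ j : v.neighborSet i, edgeWeight a b (localView v g y i j)) *
        ∏ j ∈ Finset.univ.filter (fun j => j ≠ i ∧ ¬ v.Adj i j), edgeLik a b v g y s(i, j) := by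
    intro y
    have himg : Finset.univ.filter (fun e : Sym2 (Fin N) => ¬ e.IsDiag ∧ i ∈ e) =
        (Finset.univ.erase i).image (fun j => s(i, j)) := by
      ext e
      simp only [Finset.mem_filter, Finset.mem_univ, true_and, Finset.mem_image, Finset.mem_erase,
        and_true]
      constructor
      · rintro ⟨h1, h2⟩
        obtain ⟨j, rfl⟩ := h2
        exact ⟨j, fun hj => h1 (by simp [hj]), rfl⟩
      · rintro ⟨j, hj, rfl⟩
        exact ⟨by simpa using hj.symm, by simp⟩
    rw [himg, Finset.prod_image (fun x _ y _ hxy => Sym2.congr_right.1 hxy),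
      ← Finset.prod_filter_mul_prod_filter_not _ (fun j => v.Adj i j)]
    congr 1
    · rw [Finset.prod_subtype (p := fun j => j ∈ v.neighborSet i) _ fun j => ?_]
      · exact Fintype.prod_congr _ _ fun j => edgeLik_of_adj a b y j.2
      · simpa using fun hj => hj.ne'
    · refine Finset.prod_congr ?_ fun _ _ => rfl
      ext j; simp
  have hsplit : ∀ y : Fin N → ℤˣ, likelihood a b v g y =
      (∏ e : Sym2 (Fin N) with ¬ e.IsDiag ∧ i ∈ e, edgeLik a b v g y e) *
      ∏ e : Sym2 (Fin N) with ¬ e.IsDiag ∧ i ∉ e, edgeLik a b v g y e := by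
    intro y
    unfold likelihood
    rw [← Finset.prod_filter_mul_prod_filter_not _ (fun e => i ∈ e), Finset.filter_filter,
      Finset.filter_filter]
  rw [hsplit, hsplit, hstar, hstar]
  have e1 : ∏ e : Sym2 (Fin N) with ¬ e.IsDiag ∧ i ∉ e, edgeLik a b v g z e =
      ∏ e : Sym2 (Fin N) with ¬ e.IsDiag ∧ i ∉ e, edgeLik a b v g z' e := by
    refine Finset.prod_congr rfl fun e he => edgeLik_congr _ _ _ _ fun x hx => ?_
    have : x ≠ i := by
      rintro rfl
      exact (Finset.mem_filter.1 he).2.2 hx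
    rw [hz', Function.update_of_ne this]
  have e2 : ∏ j ∈ Finset.univ.filter (fun j => j ≠ i ∧ ¬ v.Adj i j), edgeLik a b v g z s(i, j) =
      ∏ j ∈ Finset.univ.filter (fun j => j ≠ i ∧ ¬ v.Adj i j), edgeLik a b v g z' s(i, j) :=
    Finset.prod_congr rfl fun j hj => edgeLik_of_not_adj _ _ _ _ _ (Finset.mem_filter.1 hj).2.2
  rw [e1, e2]
  refine mul_le_mul_of_nonneg_right (mul_le_mul_of_nonneg_right ?_ ?_) ?_
  · simp only [hview]
    exact h
  · exact Finset.prod_nonneg fun _ _ => edgeLik_nonneg hb hba ha _ _ _ _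
  · exact Finset.prod_nonneg fun _ _ => edgeLik_nonneg hb hba ha _ _ _ _

/-- For fixed `g`, let `F` be the weight outside `T`. At most two labels lie in both `A` and `T`,
each dominated by a single term of `F`. The rest of `A` weighs at most `F`. -/
lemma sum_le_three_mul_sum {L G : Type*} [Fintype L] [Fintype G] [DecidableEq L] {W : L → G → ℝ}
    (hW : ∀ z g, 0 ≤ W z g) (A T : L → G → Prop) [∀ z g, Decidable (A z g)]
    [∀ z g, Decidable (T z g)] (hT : ∀ g, (Finset.univ.filter (T · g)).card ≤ 2)
    (hAT : ∀ z g, A z g → T z g → ∃ z', ¬ T z' g ∧ W z g ≤ W z' g) :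
    ∑ y : L × G with A y.1 y.2, W y.1 y.2 ≤ 3 * ∑ y : L × G with ¬ T y.1 y.2, W y.1 y.2 := by
  simp only [Finset.sum_filter, Fintype.sum_prod_type_right, Finset.mul_sum]
  refine Finset.sum_le_sum fun g _ => ?_
  rw [← Finset.mul_sum, ← Finset.sum_filter, ← Finset.sum_filter]
  set F := ∑ z with ¬ T z g, W z g
  have hF : 0 ≤ F := Finset.sum_nonneg fun _ _ => hW _ _
  rw [← Finset.sum_filter_add_sum_filter_not _ (fun z => T z g), Finset.filter_filter,
    Finset.filter_filter]
  have h1 : ∑ z with A z g ∧ T z g, W z g ≤ 2 * F := by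
    calc ∑ z with A z g ∧ T z g, W z g ≤ (Finset.univ.filter (fun z => A z g ∧ T z g)).card • F := by
          refine Finset.sum_le_card_nsmul _ _ _ fun z hz => ?_
          obtain ⟨z', h1, h2⟩ := hAT z g (Finset.mem_filter.1 hz).2.1 (Finset.mem_filter.1 hz).2.2
          exact h2.trans (Finset.single_le_sum (f := fun z => W z g) (fun z _ => hW z g)
            (Finset.mem_filter.2 ⟨Finset.mem_univ _, h1⟩))
      _ ≤ 2 • F := by
          refine nsmul_le_nsmul_left hF ((Finset.card_le_card ?_).trans (hT g))
          exact Finset.monotone_filter_right _ fun z _ hz => hz.2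
      _ = 2 * F := by rw [nsmul_eq_mul]; norm_num
  have h2 : ∑ z with A z g ∧ ¬ T z g, W z g ≤ F :=
    Finset.sum_le_sum_of_subset_of_nonneg
      (Finset.monotone_filter_right _ fun z _ hz => hz.2) fun _ _ _ => hW _ _
  linarith

lemma overlap_eq_one_iff {t : ℕ} (x y : Fin t → ℤˣ) : overlap x y = 1 ↔ y = x ∨ y = -x := by
  rcases Nat.eq_zero_or_pos t with rfl | ht
  · simp only [overlap, if_true, true_iff]
    exact Or.inl (Subsingleton.elim _ _)
  have hsq : ∀ u : ℤˣ, (((u : ℤ) : ℝ)) * ((u : ℤ) : ℝ) = 1 := by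
    intro u; rcases Int.units_eq_one_or u with rfl | rfl <;> norm_num
  have hle : ∀ u w : ℤˣ, (((u : ℤ) : ℝ)) * ((w : ℤ) : ℝ) ≤ 1 := by
    intro u w
    rcases Int.units_eq_one_or u with rfl | rfl <;>
      rcases Int.units_eq_one_or w with rfl | rfl <;> norm_num
  have hone : ∀ u w : ℤˣ, (((u : ℤ) : ℝ)) * ((w : ℤ) : ℝ) = 1 → w = u := by
    intro u w
    rcases Int.units_eq_one_or u with rfl | rfl <;>
      rcases Int.units_eq_one_or w with rfl | rfl <;> norm_num
  have hsum : ∀ x y : Fin t → ℤˣ, ∑ i, (((x i : ℤ) : ℝ)) * ((y i : ℤ) : ℝ) = t → y = x := by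
    intro x y h
    have : ∑ i, (1 - (((x i : ℤ) : ℝ)) * ((y i : ℤ) : ℝ)) = 0 := by
      rw [Finset.sum_sub_distrib, h]; simp
    rw [Finset.sum_eq_zero_iff_of_nonneg fun i _ => sub_nonneg.2 (hle _ _)] at this
    funext i
    exact hone _ _ (by linarith [this i (Finset.mem_univ i)])
  have ht' : (0 : ℝ) < t := by exact_mod_cast ht
  rw [overlap, if_neg ht.ne', div_eq_one_iff_eq ht'.ne', abs_eq ht'.le]
  constructor
  · rintro (h | h)
    · exact Or.inl (hsum x y h)
    · right
      refine hsum (-x) y ?_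
      simp only [Pi.neg_apply, Units.val_neg, Int.cast_neg, neg_mul, Finset.sum_neg_distrib, h,
        neg_neg]
  · rintro (rfl | rfl)
    · left; simp [hsq]
    · right; simp [hsq]

/-- A second node keeps its label and so fixes the global sign. With a single node, the reversal
would be a global sign change and leave the overlap at one. -/
lemma overlap_update_ne_one {t : ℕ} (ht : 2 ≤ t) {x z : Fin t → ℤˣ} (h : overlap x z = 1)
    (i : Fin t) : overlap x (Function.update z i (-z i)) ≠ 1 := by
  have hne : ∀ u : ℤˣ, u ≠ -u := by decide
  rw [overlap_eq_one_iff] at h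
  rw [Ne, overlap_eq_one_iff]
  have : Nontrivial (Fin t) := Fin.nontrivial_iff_two_le.2 ht
  obtain ⟨j, hj⟩ := exists_ne i
  intro h'
  have hi' : ∀ y, Function.update z i (-z i) = y → -z i = y i ∧ z j = y j := by
    rintro y rfl
    simp [Function.update_of_ne hj]
  rcases h with rfl | rfl <;> rcases h' with h' | h' <;> obtain ⟨h1, h2⟩ := hi' _ h'
  · exact hne _ h1.symm
  · exact hne _ h2
  · exact hne _ h2.symm
  · exact hne _ h1.symm

lemma card_filter_overlap_le {t : ℕ} (x : Fin t → ℤˣ) [DecidablePred fun z => overlap x z = 1] :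
    (Finset.univ.filter fun z => overlap x z = 1).card ≤ 2 := by
  classical
  refine (Finset.card_le_card (t := {x, -x}) fun z hz => ?_).trans Finset.card_le_two
  simpa using (overlap_eq_one_iff x z).1 (Finset.mem_filter.1 hz).2

end Likelihood

/-! ### The joint law of labels and graph for a fixed visibility graph -/

section Marks

variable {Ω : Type*} [MeasurableSpace Ω] {P : Measure Ω} {d : ℕ} {lam : ℝ}
  {X : ℕ → Ω → Space d} {Z : ℕ → Ω → ℤˣ} {U : Sym2 ℕ → Ω → ℝ}

open Classical in
/-- The random graph on `Fin N` in which only the pairs adjacent in `v` may be joined. -/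
def markGraph (Z : ℕ → Ω → ℤˣ) (U : Sym2 ℕ → Ω → ℝ) (a b : ℝ) {N : ℕ} (v : SimpleGraph (Fin N))
    (ω : Ω) : SimpleGraph (Fin N) where
  Adj i j := i ≠ j ∧ U s((i : ℕ), (j : ℕ)) ω ≤
    if v.Adj i j then (if Z i ω = Z j ω then a else b) else 0
  symm := ⟨by
    rintro i j ⟨hij, h⟩
    refine ⟨hij.symm, ?_⟩
    rw [Sym2.eq_swap]
    simpa only [eq_comm, v.adj_comm] using h⟩
  loopless := ⟨fun _ h => h.1 rfl⟩

/-- The joint observation of labels and graph. -/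
def labelledGraph (Z : ℕ → Ω → ℤˣ) (U : Sym2 ℕ → Ω → ℝ) (a b : ℝ) {N : ℕ}
    (v : SimpleGraph (Fin N)) (ω : Ω) : (Fin N → ℤˣ) × SimpleGraph (Fin N) :=
  (fun i => Z i ω, markGraph Z U a b v ω)

/-- A pair of distinct nodes as a pair of distinct indices. -/
def toPairs {N : ℕ} (e : {e : Sym2 (Fin N) // ¬ e.IsDiag}) : Pairs :=
  ⟨e.1.map Fin.val, by rw [Sym2.isDiag_map Fin.val_injective]; exact e.2⟩

lemma toPairs_injective {N : ℕ} : Function.Injective (toPairs (N := N)) := by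
  intro x y hxy
  exact Subtype.ext (Sym2.map.injective Fin.val_injective (congrArg Subtype.val hxy))

open Classical in
/-- The set of values of the edge variable at `e` that agree with the graph `g`. -/
noncomputable def edgeEvent (a b : ℝ) {N : ℕ} (v g : SimpleGraph (Fin N)) (z : Fin N → ℤˣ)
    (e : Sym2 (Fin N)) : Set ℝ :=
  if e ∈ g.edgeSet then Set.Iic (edgeProb a b v z e) else Set.Ioi (edgeProb a b v z e)

lemma measurableSet_edgeEvent (a b : ℝ) {N : ℕ} (v g : SimpleGraph (Fin N)) (z : Fin N → ℤˣ)
    (e : Sym2 (Fin N)) : MeasurableSet (edgeEvent a b v g z e) := by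
  unfold edgeEvent
  split_ifs <;> measurability

open Classical in
lemma setOf_labelledGraph_eq {Ω : Type*} (Z : ℕ → Ω → ℤˣ) (U : Sym2 ℕ → Ω → ℝ) (a b : ℝ) {N : ℕ}
    (v : SimpleGraph (Fin N)) (y : (Fin N → ℤˣ) × SimpleGraph (Fin N)) :
    {ω | labelledGraph Z U a b v ω = y} = {ω | (∀ i : Fin N, Z i ω = y.1 i) ∧
      ∀ x : {e : Sym2 (Fin N) // ¬ e.IsDiag}, U (toPairs x) ω ∈ edgeEvent a b v y.2 y.1 x} := by
  obtain ⟨z, g⟩ := y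
  ext ω
  simp only [labelledGraph, Set.mem_ofPred_eq, Prod.mk.injEq, funext_iff, and_congr_right_iff]
  intro hz
  have key : ∀ i j : Fin N, ∀ hij : i ≠ j, U (toPairs ⟨s(i, j), by simpa using hij⟩) ω ∈
      edgeEvent a b v g z s(i, j) ↔ ((markGraph Z U a b v ω).Adj i j ↔ g.Adj i j) := by
    intro i j hij
    have h1 : (∀ x ∈ s(i, j), ∀ y ∈ s(i, j), z x = z y) ↔ z i = z j := by
      simp only [Sym2.mem_iff]
      constructor
      · exact fun h => h i (Or.inl rfl) j (Or.inr rfl)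
      · rintro h x (rfl | rfl) y (rfl | rfl) <;> simp [h]
    have h2 : edgeProb a b v z s(i, j) =
        if v.Adj i j then (if Z i ω = Z j ω then a else b) else 0 := by
      rw [edgeProb, hz, hz]
      by_cases hv : v.Adj i j
      · rw [if_pos hv, if_pos (v.mem_edgeSet.2 hv)]
        exact if_congr h1 rfl rfl
      · rw [if_neg hv, if_neg fun h => hv (v.mem_edgeSet.1 h)]
    have h3 : (markGraph Z U a b v ω).Adj i j ↔ U s((i : ℕ), (j : ℕ)) ω ≤
        edgeProb a b v z s(i, j) := by
      rw [h2]
      exact and_iff_right hij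
    rw [h3, edgeEvent]
    by_cases hg : g.Adj i j
    · rw [if_pos (g.mem_edgeSet.2 hg), iff_true_right hg]
      rfl
    · rw [if_neg fun h => hg (g.mem_edgeSet.1 h), iff_false_right hg, not_le]
      rfl
  constructor
  · rintro rfl ⟨x, hx⟩
    induction x with | _ i j =>
    exact (key i j (by simpa using hx)).2 Iff.rfl
  · intro hx
    ext i j
    by_cases hij : i = j
    · subst hij
      simp
    · exact (key i j hij).1 (hx ⟨s(i, j), by simpa using hij⟩)

lemma measurableSet_labelledGraph {Ω : Type*} [MeasurableSpace Ω] {Z : ℕ → Ω → ℤˣ} {U : Sym2 ℕ → Ω → ℝ}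
    (hZ : ∀ i, Measurable (Z i)) (hU : ∀ e : Pairs, Measurable (U e)) (a b : ℝ) {N : ℕ}
    (v : SimpleGraph (Fin N)) (A : Set ((Fin N → ℤˣ) × SimpleGraph (Fin N))) :
    MeasurableSet {ω | labelledGraph Z U a b v ω ∈ A} := by
  have : {ω | labelledGraph Z U a b v ω ∈ A} = ⋃ y ∈ A, {ω | labelledGraph Z U a b v ω = y} := by
    ext; simp
  rw [this]
  refine MeasurableSet.biUnion A.to_countable fun y _ => ?_
  have : {ω | labelledGraph Z U a b v ω = y} = (⋂ i : Fin N, {ω | Z i ω = y.1 i}) ∩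
      ⋂ x : {e : Sym2 (Fin N) // ¬ e.IsDiag}, {ω | U (toPairs x) ω ∈ edgeEvent a b v y.2 y.1 x} := by
    rw [setOf_labelledGraph_eq]
    ext; simp
  rw [this]
  exact (MeasurableSet.iInter fun i => measurableSet_eq_fun (hZ _) measurable_const).inter
    (MeasurableSet.iInter fun x => hU _ (measurableSet_edgeEvent _ _ _ _ _ _))

lemma IsMarkedPoissonProcess.real_labelledGraph_eq [IsProbabilityMeasure P]
    (h : IsMarkedPoissonProcess P lam X Z U) {a b : ℝ} (hb : 0 ≤ b) (hba : b < a) (ha : a ≤ 1)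
    {N : ℕ} (v : SimpleGraph (Fin N)) (y : (Fin N → ℤˣ) × SimpleGraph (Fin N)) :
    P.real {ω | labelledGraph Z U a b v ω = y} = (1 / 2) ^ N * likelihood a b v y.2 y.1 := by
  classical
  rw [setOf_labelledGraph_eq, h.law_marks Fin.val_injective toPairs_injective y.1
    (B := fun x => edgeEvent a b v y.2 y.1 x.1) fun x => measurableSet_edgeEvent _ _ _ _ _ _, Fintype.card_fin, likelihood]
  congr 1
  rw [Finset.prod_subtype (p := fun x : Sym2 (Fin N) => ¬ x.IsDiag) _ (by simp)]
  refine Finset.prod_congr rfl fun x _ => ?_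
  have hm := edgeProb_mem hb hba ha v y.1 x
  simp only [edgeEvent, edgeLik]
  split_ifs
  · exact h.real_U_le _ hm.1 hm.2
  · exact h.real_U_gt _ hm.1 hm.2

end Marks

/-! ### Ambiguous nodes force failure, and separated centres make them likely -/

section Marks

variable {Ω : Type*} [MeasurableSpace Ω] {P : Measure Ω} {d : ℕ} {lam : ℝ}
  {X : ℕ → Ω → Space d} {Z : ℕ → Ω → ℤˣ} {U : Sym2 ℕ → Ω → ℝ}

/-- The labelled graphs with at least two nodes, one of which may be relabelled without a loss of
likelihood. -/
def flippable (a b : ℝ) {N : ℕ} (v : SimpleGraph (Fin N)) :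
    Set ((Fin N → ℤˣ) × SimpleGraph (Fin N)) :=
  {y | 2 ≤ N ∧ ∃ (i : Fin N) (_ : Fintype (v.neighborSet i)),
    localView v y.2 y.1 i ∈ ambiguous a b (v.neighborSet i)}

/-- The labelled graphs for which the estimate `t` fails. -/
def failure {N : ℕ} (t : SimpleGraph (Fin N) → Fin N → ℤˣ) :
    Set ((Fin N → ℤˣ) × SimpleGraph (Fin N)) :=
  {y | overlap (t y.2) y.1 ≠ 1}

lemma star_eq_localView {Ω : Type*} (Z : ℕ → Ω → ℤˣ) (U : Sym2 ℕ → Ω → ℝ) (a b : ℝ) {N : ℕ}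
    (v : SimpleGraph (Fin N)) (i : Fin N) (ω : Ω) :
    star Z U a b i (fun j : v.neighborSet i => ((j : Fin N) : ℕ)) ω =
      localView v (labelledGraph Z U a b v ω).2 (labelledGraph Z U a b v ω).1 i := by
  funext j
  have hj : v.Adj i j := j.2
  simp only [star, localView, labelledGraph, markGraph, hj, if_true, ne_eq, hj.ne,
    not_false_eq_true, true_and]

/-- The prior on labels is uniform, so up to a constant the likelihood is the joint weight, and
`sum_le_three_mul_sum` applies with `T` the success of the estimate. -/
lemma IsMarkedPoissonProcess.real_flippable_le [IsProbabilityMeasure P]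
    (h : IsMarkedPoissonProcess P lam X Z U) {a b : ℝ} (hb : 0 ≤ b) (hba : b < a) (ha : a ≤ 1)
    {N : ℕ} (v : SimpleGraph (Fin N)) (t : SimpleGraph (Fin N) → Fin N → ℤˣ) :
    P.real {ω | labelledGraph Z U a b v ω ∈ flippable a b v} ≤
      3 * P.real {ω | labelledGraph Z U a b v ω ∈ failure t} := by
  classical
  have hsum : ∀ A : Set ((Fin N → ℤˣ) × SimpleGraph (Fin N)),
      P.real {ω | labelledGraph Z U a b v ω ∈ A} =
        ∑ y with y ∈ A, (1 / 2) ^ N * likelihood a b v y.2 y.1 := by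
    intro A
    simp only [← h.real_labelledGraph_eq hb hba ha]
    rw [← measureReal_eq_sum fun y =>
      measurableSet_labelledGraph h.measurable_Z (fun e => h.measurable_U e) a b v {y}]
    simp
  have hlik : ∀ g z, 0 ≤ likelihood a b v g z := fun g z =>
    Finset.prod_nonneg fun _ _ => edgeLik_nonneg hb hba ha _ _ _ _
  rw [hsum, hsum]
  have hmain := sum_le_three_mul_sum (W := fun z g => (1 / 2) ^ N * likelihood a b v g z)
    (fun z g => mul_nonneg (by positivity) (hlik _ _))
    (fun z g => (z, g) ∈ flippable a b v) (fun z g => overlap (t g) z = 1)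
    (fun g => card_filter_overlap_le _) (by
      rintro z g ⟨hN, i, _, hi⟩ hT
      exact ⟨Function.update z i (-z i), overlap_update_ne_one hN hT i,
    mul_le_mul_of_nonneg_left (likelihood_le_update hb hba ha hi) (by positivity)⟩)
  convert! hmain using 2
  refine Finset.sum_congr ?_ fun _ _ => rfl
  ext y
  rw [Finset.mem_filter, Finset.mem_filter]
  rfl

/-- The conditions `hv` and `hv'` say that the closed neighbourhoods of the centres are disjoint.
Their observations are therefore independent. -/
lemma IsMarkedPoissonProcess.real_not_flippable_le [IsProbabilityMeasure P]
    (h : IsMarkedPoissonProcess P lam X Z U) {a b : ℝ} (hb : 0 ≤ b) (hba : b < a) (ha : a ≤ 1)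
    {r C : ℝ}
    (hrC : ∀ (J : Type) [Fintype J] [DecidableEq J], ∀ A : Finset (J → ℤˣ × Bool),
        (∀ σ, σ ∈ A ↔ σ ∈ ambiguous a b J) →
        C * r ^ Fintype.card J ≤ ∑ σ ∈ A, ∏ j, edgeWeight a b (σ j) / 2)
    {N : ℕ} (hN : 2 ≤ N) (v : SimpleGraph (Fin N)) {I : Type*} [Fintype I] (c : I → Fin N)
    (hc : c.Injective) (hv : ∀ i i', ¬ v.Adj (c i) (c i'))
    (hv' : ∀ i i' j, v.Adj (c i) j → v.Adj (c i') j → i = i') :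
    P.real {ω | labelledGraph Z U a b v ω ∉ flippable a b v} ≤
      ∏ i, (1 - C * r ^ (v.neighborSet (c i)).ncard) := by
  classical
  have hinj : Function.Injective (Sum.elim (fun i => (c i : ℕ))
      (fun p : (i : I) × v.neighborSet (c i) => ((p.2 : Fin N) : ℕ))) := by
    rintro (i | ⟨i, j⟩) (i' | ⟨i', j'⟩) hij
    all_goals simp only [Sum.elim_inl, Sum.elim_inr, Fin.val_inj] at hij
    · rw [hc hij]
    · exact absurd (hij ▸ j'.2) (hv _ _)
    · exact absurd (hij ▸ j.2) (hv _ _)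
    · obtain rfl := hv' _ _ _ j.2 (hij ▸ j'.2)
      rw [Subtype.ext hij]
  have h1 := h.real_forall_star_notMem_le hb hba ha hrC
    (J := fun i => v.neighborSet (c i)) (c := fun i => (c i : ℕ))
    (nb := fun i j => ((j : Fin N) : ℕ)) hinj
  refine (measureReal_mono ?_).trans (h1.trans_eq ?_)
  · intro ω hω i hi
    rw [star_eq_localView] at hi
    exact hω ⟨hN, c i, inferInstance, hi⟩
  · refine Finset.prod_congr rfl fun i _ => ?_
    rw [← Nat.card_coe_set_eq, Nat.card_eq_fintype_card]

end Marks

/-! ### Conditioning on discrete variables, and measurability of counts -/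

section Conditioning

variable {Ω : Type*} [MeasurableSpace Ω] {P : Measure Ω}

/-- The probability of an event that depends on a discrete random variable `T` and is independent
of `T` for each fixed value of `T`. -/
lemma lintegral_measure_eq {β : Type*} [Countable β] [MeasurableSpace β] [DiscreteMeasurableSpace β]
    {T : Ω → β} (hT : Measurable T) {S : β → Set Ω} (hS : ∀ t, MeasurableSet (S t))
    (h : ∀ t, P (T ⁻¹' {t} ∩ S t) = P (T ⁻¹' {t}) * P (S t)) :
    P {ω | ω ∈ S (T ω)} = ∫⁻ ω, P (S (T ω)) ∂P := by
  have hset : {ω | ω ∈ S (T ω)} = ⋃ t, T ⁻¹' {t} ∩ S t := by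
    ext; simp
  rw [hset, measure_iUnion, ← lintegral_map (f := fun t => P (S t)) .of_discrete hT,
    lintegral_countable']
  · refine tsum_congr fun t => ?_
    rw [h, mul_comm, Measure.map_apply hT (measurableSet_singleton t)]
  · intro t t' hne
    rw [Function.onFun, Set.disjoint_left]
    rintro ω ⟨h1, -⟩ ⟨h2, -⟩
    exact hne (h1.symm.trans h2)
  · exact fun t => (hT (measurableSet_singleton t)).inter (hS t)

lemma measurable_sigmaMk {E : Type*} [MeasurableSpace E] {β : ℕ → Type*} [∀ N, Countable (β N)]
    {K : E → ℕ} (hK : Measurable K) {F : (N : ℕ) → E → β N}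
    (hF : ∀ N y, MeasurableSet {x | F N x = y}) :
    @Measurable _ _ _ ⊤ (fun x => (⟨K x, F (K x) x⟩ : (N : ℕ) × β N)) := by
  let _ : MeasurableSpace ((N : ℕ) × β N) := ⊤
  refine measurable_to_countable' ?_
  rintro ⟨N, y⟩
  have : (fun x => (⟨K x, F (K x) x⟩ : (N : ℕ) × β N)) ⁻¹' {⟨N, y⟩} =
      K ⁻¹' {N} ∩ {x | F N x = y} := by
    ext x
    simp only [Set.mem_preimage, Set.mem_singleton_iff, Sigma.mk.injEq, Set.mem_inter_iff,
      Set.mem_ofPred_eq]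
    constructor
    · rintro ⟨rfl, h⟩
      exact ⟨rfl, eq_of_heq h⟩
    · rintro ⟨rfl, h⟩
      exact ⟨rfl, heq_of_eq h⟩
  rw [this]
  exact (hK (measurableSet_singleton N)).inter (hF N y)

/-- A finite value of the count is attained on a countable union over finite index sets, and the
value `⊤` on the complement of all these events. -/
lemma measurable_encard {E : Type*} [MeasurableSpace E] {s : ℕ → Set E}
    (hs : ∀ i, MeasurableSet (s i)) : Measurable fun x => {i | x ∈ s i}.encard := by
  have heq : ∀ u : Finset ℕ, MeasurableSet {x | {i | x ∈ s i} = ↑u} := by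
    intro u
    have : {x | {i | x ∈ s i} = (u : Set ℕ)} = ⋂ i, {x | x ∈ s i ↔ i ∈ u} := by
      ext x
      simp [Set.ext_iff]
    rw [this]
    refine MeasurableSet.iInter fun i => ?_
    by_cases hi : i ∈ u
    · simpa [hi] using hs i
    · simp only [hi, iff_false]
      exact (hs i).compl
  have hnat : ∀ k : ℕ, MeasurableSet {x | {i | x ∈ s i}.encard = k} := by
    intro k
    have : {x | {i | x ∈ s i}.encard = k} =
        ⋃ u ∈ {u : Finset ℕ | u.card = k}, {x | {i | x ∈ s i} = ↑u} := by
      ext x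
      simp only [Set.mem_ofPred_eq, Set.mem_iUnion, exists_prop]
      constructor
      · intro hx
        have hfin := Set.finite_of_encard_eq_coe hx
        refine ⟨hfin.toFinset, ?_, by simp⟩
        rw [hfin.encard_eq_coe_toFinset_card] at hx
        exact_mod_cast hx
      · rintro ⟨u, hu, hx⟩
        rw [hx, Set.encard_coe_eq_coe_finsetCard, hu]
    rw [this]
    exact MeasurableSet.biUnion (Set.to_countable _) fun u _ => heq u
  refine measurable_to_countable' fun k => ?_
  induction k with
  | top =>
    have : (fun x => {i | x ∈ s i}.encard) ⁻¹' {⊤} =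
        (⋃ k : ℕ, {x | {i | x ∈ s i}.encard = k})ᶜ := by
      ext x
      simp only [Set.mem_preimage, Set.mem_singleton_iff, Set.mem_compl_iff, Set.mem_iUnion,
        Set.mem_ofPred_eq]
      rw [← not_iff_not, not_not, ← ne_eq, ENat.ne_top_iff_exists]
      exact exists_congr fun _ => eq_comm
    rw [this]
    exact (MeasurableSet.iUnion hnat).compl
  | coe k => exact hnat k

end Conditioning

/-! ### Reducing the locations to a countable pattern -/

section Pattern

variable {Ω : Type*} [MeasurableSpace Ω] {P : Measure Ω} {d : ℕ} {lam : ℝ}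
  {X : ℕ → Ω → Space d} {Z : ℕ → Ω → ℤˣ} {U : Sym2 ℕ → Ω → ℝ}

/-- The connection radius `log(n)^{1/d}`. -/
noncomputable def radius (d n : ℕ) : ℝ := (Real.log n) ^ (1 / (d : ℝ))

/-- The pairs of nodes within the connection radius. -/
def visibleGraph (n : ℕ) {N : ℕ} (x : Fin N → Space d) : SimpleGraph (Fin N) where
  Adj i j := i ≠ j ∧ torusDist n (x i) (x j) ≤ radius d n
  symm := ⟨by
    rintro i j ⟨hij, h⟩
    refine ⟨hij.symm, ?_⟩
    rwa [show torusDist n (x j) (x i) = torusDist n (x i) (x j) by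
      simp only [torusDist, abs_sub_comm]]⟩
  loopless := ⟨fun _ h => h.1 rfl⟩

lemma graph_eq_markGraph {Ω : Type*} (X : ℕ → Ω → Space d) (Z : ℕ → Ω → ℤˣ)
    (U : Sym2 ℕ → Ω → ℝ) (a b : ℝ) (n : ℕ) (ω : Ω) :
    graph X Z U (logConn d a) (logConn d b) n ω =
      markGraph Z U a b (visibleGraph n (locations X n ω)) ω := by
  classical
  ext i j
  refine and_congr_right fun hij => ?_
  have hv : (visibleGraph n (locations X n ω)).Adj i j ↔
      torusDist n (X i ω) (X j ω) ≤ (Real.log n) ^ (1 / (d : ℝ)) := and_iff_right hij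
  by_cases h : torusDist n (X i ω) (X j ω) ≤ (Real.log n) ^ (1 / (d : ℝ))
  · simp only [logConn, h, hv, if_true]
  · simp only [logConn, h, hv, if_false, ite_self]

/-- The number of nodes, the visibility graph, and the estimator as a function of the graph. -/
abbrev Pattern : Type :=
  (N : ℕ) × (SimpleGraph (Fin N) × (SimpleGraph (Fin N) → Fin N → ℤˣ))

instance : MeasurableSpace Pattern := ⊤

/-- The part of the information on the locations that matters for the success of `τ`. -/
noncomputable def pattern (n : ℕ) (τ : (N : ℕ) → (Fin N → Space d) → SimpleGraph (Fin N) → (Fin N → ℤˣ))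
    (X : ℕ → Ω → Space d) (ω : Ω) : Pattern :=
  ⟨numNodes X n ω, visibleGraph n (locations X n ω), τ _ (locations X n ω)⟩

lemma measurableSet_cube (d n : ℕ) : MeasurableSet (cube d n) := by
  have : cube d n = ⋂ k, {x : Space d | x k ∈ Set.Icc (-(side d n / 2)) (side d n / 2)} := by
    ext; simp [cube]
  rw [this]
  exact MeasurableSet.iInter fun k =>
    (by fun_prop : Measurable fun x : Space d => x k) measurableSet_Icc

lemma measurable_count {Ω : Type*} [MeasurableSpace Ω] {X : ℕ → Ω → Space d}
    (hX : ∀ i, Measurable (X i)) {B : Set (Space d)} (hB : MeasurableSet B) :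
    Measurable (count X B) :=
  measurable_encard (s := fun i => X i ⁻¹' B) fun i => hX i hB

lemma numNodes_eq {Ω : Type*} (X : ℕ → Ω → Space d) (n : ℕ) (ω : Ω) :
    numNodes X n ω = (count X (cube d n) ω).toNat := rfl

lemma measurable_numNodes {Ω : Type*} [MeasurableSpace Ω] {X : ℕ → Ω → Space d}
    (hX : ∀ i, Measurable (X i)) (n : ℕ) : Measurable (numNodes X n) :=
  (Measurable.of_discrete (f := ENat.toNat)).comp (measurable_count hX (measurableSet_cube d n))

lemma measurable_torusDist (n : ℕ) :
    Measurable fun p : Space d × Space d => torusDist n p.1 p.2 := by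
  unfold torusDist
  refine Continuous.measurable ?_
  fun_prop

lemma measurable_pattern {Ω : Type*} [MeasurableSpace Ω] {X : ℕ → Ω → Space d}
    (hX : ∀ i, Measurable (X i)) (n : ℕ)
    {τ : (N : ℕ) → (Fin N → Space d) → SimpleGraph (Fin N) → (Fin N → ℤˣ)}
    (hτ : ∀ N G, Measurable (fun x => τ N x G)) : Measurable (pattern n τ X) := by
  refine measurable_sigmaMk (β := fun N =>
    SimpleGraph (Fin N) × (SimpleGraph (Fin N) → Fin N → ℤˣ)) (measurable_numNodes hX n)
    (F := fun N ω => (visibleGraph n (fun i : Fin N => X i ω), τ N (fun i : Fin N => X i ω))) ?_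
  rintro N ⟨v, t⟩
  have : {ω | (visibleGraph n (fun i : Fin N => X i ω), τ N (fun i : Fin N => X i ω)) = (v, t)} =
      (⋂ i : Fin N, ⋂ j : Fin N, {ω | (i ≠ j ∧ torusDist n (X i ω) (X j ω) ≤ radius d n) ↔
        v.Adj i j}) ∩ ⋂ G, {ω | τ N (fun i : Fin N => X i ω) G = t G} := by
    ext ω
    simp only [Set.mem_ofPred_eq, Prod.mk.injEq, Set.mem_inter_iff, Set.mem_iInter, funext_iff]
    refine and_congr ?_ Iff.rfl
    rw [SimpleGraph.ext_iff, funext_iff]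
    refine forall_congr' fun i => ?_
    rw [funext_iff]
    exact forall_congr' fun j => by rw [eq_iff_iff]; rfl
  rw [this]
  refine MeasurableSet.inter (MeasurableSet.iInter fun i => MeasurableSet.iInter fun j => ?_)
    (MeasurableSet.iInter fun G => ?_)
  · have hd : MeasurableSet {ω | torusDist n (X i ω) (X j ω) ≤ radius d n} :=
      ((measurable_torusDist n).comp ((hX i).prodMk (hX j))) measurableSet_Iic
    have hd' : MeasurableSet {ω | i ≠ j ∧ torusDist n (X i ω) (X j ω) ≤ radius d n} :=
      (MeasurableSet.const (i ≠ j)).inter hd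
    by_cases hv : v.Adj i j
    · simpa only [hv, iff_true] using hd'
    · simp only [hv, iff_false]
      exact hd'.compl
  · exact ((hτ N G).comp (measurable_pi_lambda _ fun i => hX i)) (measurableSet_singleton (t G))

/-- Conditioning on the locations. Only the pattern matters, and it takes countably many values, so
no disintegration is needed: for each value, the marks are independent of the event that the pattern
equals it. -/
lemma IsMarkedPoissonProcess.measure_pattern [IsProbabilityMeasure P]
    (h : IsMarkedPoissonProcess P lam X Z U) (a b : ℝ) (n : ℕ)
    {τ : (N : ℕ) → (Fin N → Space d) → SimpleGraph (Fin N) → (Fin N → ℤˣ)}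
    (hτ : ∀ N G, Measurable (fun x => τ N x G))
    (S : (t : Pattern) → Set ((Fin t.1 → ℤˣ) × SimpleGraph (Fin t.1))) :
    P {ω | labelledGraph Z U a b (pattern n τ X ω).2.1 ω ∈ S (pattern n τ X ω)} =
      ∫⁻ ω, P {ω' | labelledGraph Z U a b (pattern n τ X ω).2.1 ω' ∈ S (pattern n τ X ω)} ∂P := by
  refine lintegral_measure_eq (measurable_pattern h.poisson.measurable n hτ)
    (S := fun t => {ω' | labelledGraph Z U a b t.2.1 ω' ∈ S t})
    (fun t => measurableSet_labelledGraph h.measurable_Z (fun e => h.measurable_U e) _ _ _ _) ?_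
  intro t
  refine (IndepFun_iff _ _ _).1 h.indep_X_marks _ _ ?_ ?_
  -- Independence requires events in the σ-algebras generated by the locations and by the marks.
  -- Replacing the σ-algebra on `Ω` by each in turn lets the general measurability lemmas supply
  -- this.
  · let _ : MeasurableSpace Ω := MeasurableSpace.comap (fun ω i => X i ω) inferInstance
    refine measurable_pattern (X := X) (fun i => ?_) n hτ (measurableSet_singleton t)
    exact (measurable_pi_apply i).comp (comap_measurable (fun ω i => X i ω))
  · let _ : MeasurableSpace Ω := MeasurableSpace.comap
      (fun ω => ((fun i => Z i ω), (fun e : Pairs => U e ω))) inferInstance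
    have hm : Measurable (fun ω => ((fun i => Z i ω), (fun e : Pairs => U e ω))) :=
      comap_measurable _
    refine measurableSet_labelledGraph (fun i => ?_) (fun e => ?_) a b t.2.1 (S t)
    · exact (measurable_pi_apply i).comp (measurable_fst.comp hm)
    · exact (measurable_pi_apply e).comp (measurable_snd.comp hm)

lemma IsMarkedPoissonProcess.measure_flippable_le [IsProbabilityMeasure P]
    (h : IsMarkedPoissonProcess P lam X Z U) {a b : ℝ} (hb : 0 ≤ b) (hba : b < a) (ha : a ≤ 1)
    (n : ℕ) {τ : (N : ℕ) → (Fin N → Space d) → SimpleGraph (Fin N) → (Fin N → ℤˣ)}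
    (hτ : ∀ N G, Measurable (fun x => τ N x G)) :
    P {ω | labelledGraph Z U a b (pattern n τ X ω).2.1 ω ∈
        flippable a b (pattern n τ X ω).2.1} ≤
      3 * P {ω | labelledGraph Z U a b (pattern n τ X ω).2.1 ω ∈
        failure (pattern n τ X ω).2.2} := by
  rw [h.measure_pattern a b n hτ (fun t => flippable a b t.2.1),
    h.measure_pattern a b n hτ (fun t => failure t.2.2),
    ← lintegral_const_mul' _ _ (by norm_num)]
  refine lintegral_mono fun ω => ?_
  have := h.real_flippable_le hb hba ha (pattern n τ X ω).2.1 (pattern n τ X ω).2.2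
  simp only [measureReal_def] at this
  rw [← ENNReal.toReal_le_toReal (measure_ne_top _ _)
    (ENNReal.mul_ne_top (by norm_num) (measure_ne_top _ _)), ENNReal.toReal_mul]
  exact this

end Pattern

/-! ### Toroidal distance away from the boundary, and the ordering of the nodes -/

section Geometry

variable {d : ℕ}

lemma side_nonneg (d n : ℕ) : 0 ≤ side d n := Real.rpow_nonneg (Nat.cast_nonneg n) _

lemma mem_cube_iff {n : ℕ} {x : Space d} : x ∈ cube d n ↔ ‖WithLp.ofLp x‖ ≤ side d n / 2 := by
  rw [pi_norm_le_iff_of_nonneg (by linarith [side_nonneg d n])]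
  simp only [cube, Set.mem_ofPred_eq, Set.mem_Icc, Real.norm_eq_abs, abs_le]

lemma isBounded_cube (d n : ℕ) : Bornology.IsBounded (cube d n) := by
  have h : cube d n = WithLp.ofLp ⁻¹' Metric.closedBall (0 : Fin d → ℝ) (side d n / 2) := by
    ext x
    rw [mem_cube_iff, Set.mem_preimage, mem_closedBall_zero_iff]
  rw [h]
  exact (PiLp.antilipschitzWith_ofLp 2 _).isBounded_preimage Metric.isBounded_closedBall

/-- Here `|x k - y k| < side d n - R`, so going around the torus in coordinate `k` would cost more
than `R`. The minimum is therefore the direct difference in every coordinate. -/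
lemma dist_le_of_torusDist_le {n : ℕ} {R : ℝ} {x y : Space d}
    (hx : ∀ k, |x k| < side d n / 2 - R) (hy : y ∈ cube d n) (h : torusDist n x y ≤ R) :
    dist x y ≤ R := by
  have hk : ∀ k, min |x k - y k| (side d n - |x k - y k|) = |x k - y k| := by
    intro k
    have h1 : min |x k - y k| (side d n - |x k - y k|) ≤ R := by
      refine le_trans ?_ h
      refine (le_abs_self _).trans ?_
      exact PiLp.norm_apply_le (p := 2) (WithLp.toLp 2 (fun k : Fin d =>
        min |x k - y k| (side d n - |x k - y k|))) k
    have h2 : |y k| ≤ side d n / 2 := abs_le.2 (hy k)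
    have h3 : |x k - y k| ≤ |x k| + |y k| := abs_sub _ _
    rcases min_le_iff.1 h1 with h4 | h4
    · refine min_eq_left ?_
      have := hx k
      linarith
    · have := hx k
      linarith
  refine le_trans (le_of_eq ?_) h
  rw [dist_eq_norm, torusDist, EuclideanSpace.norm_eq, EuclideanSpace.norm_eq]
  simp only [hk, Real.norm_eq_abs, abs_abs, PiLp.sub_apply]

/-- The cube is a ball of the maximum norm by which the points are ordered. Hence the indices of its
points are downward closed, and this lemma identifies them with the nodes `0, …, N_n - 1`. -/
lemma mem_iff_lt_ncard {S : Set ℕ} (hS : S.Finite) (hl : ∀ i j, j < i → i ∈ S → j ∈ S) (i : ℕ) :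
    i ∈ S ↔ i < S.ncard := by
  obtain ⟨m, hm⟩ : ∃ m, m ∉ S := hS.exists_notMem
  classical
  have hex : ∃ m, m ∉ S := ⟨m, hm⟩
  have hSm : S = Finset.range (Nat.find hex) := by
    ext j
    rw [Finset.coe_range, Set.mem_Iio]
    constructor
    · intro hj
      by_contra hlt
      rcases (not_lt.1 hlt).eq_or_lt with h | h
      · exact Nat.find_spec hex (h ▸ hj)
      · exact Nat.find_spec hex (hl _ _ h hj)
    · exact fun hj => not_not.1 (Nat.find_min hex hj)
  rw [hSm, Set.ncard_coe_finset, Finset.card_range]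
  simp

end Geometry

/-! ### From separated cells to independent ambiguous nodes -/

section Cells

variable {Ω : Type*} [MeasurableSpace Ω] {P : Measure Ω} {d : ℕ} {lam : ℝ}
  {X : ℕ → Ω → Space d} {Z : ℕ → Ω → ℤˣ} {U : Sym2 ℕ → Ω → ℝ}

/-- The points that may be visible from a point within distance `1` of `c`. -/
def annulus (R : ℝ) (c : Space d) : Set (Space d) :=
  Metric.closedBall c (R + 1) \ Metric.closedBall c 1

/-- A bound for the probability that the only point within distance `1` of `c`, if there is one,
cannot be relabelled without a loss of likelihood. -/
noncomputable def cellFactor (r C R : ℝ) (X : ℕ → Ω → Space d) (c : Space d) (ω : Ω) : ℝ :=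
  if count X (Metric.closedBall c 1) ω = 1 then 1 - C * r ^ (count X (annulus R c) ω).toNat else 1

/-- For fixed locations, the centres are the points that are alone in their unit balls. Neighbours
of such a point lie in the annulus of its cell, because the unit ball holds no other point. Since `r
≤ 1`, the annulus count may replace the number of neighbours. -/
lemma IsMarkedPoissonProcess.real_not_flippable_le_prod [IsProbabilityMeasure P]
    (h : IsMarkedPoissonProcess P lam X Z U) {a b : ℝ} (hb : 0 ≤ b) (hba : b < a) (ha : a ≤ 1)
    {r C : ℝ} (hr0 : 0 ≤ r) (hr1 : r ≤ 1) (hC0 : 0 ≤ C) (hC1 : C ≤ 1)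
    (hrC : ∀ (J : Type) [Fintype J] [DecidableEq J], ∀ A : Finset (J → ℤˣ × Bool),
        (∀ σ, σ ∈ A ↔ σ ∈ ambiguous a b J) →
        C * r ^ Fintype.card J ≤ ∑ σ ∈ A, ∏ j, edgeWeight a b (σ j) / 2)
    {n : ℕ} {I : Type*} [Fintype I] {c : I → Space d} (hR : 0 ≤ radius d n)
    (hsep : ∀ i i', i ≠ i' → 2 * (radius d n + 1) < dist (c i) (c i'))
    (hin : ∀ i, ∀ x ∈ Metric.closedBall (c i) (radius d n + 1), x ∈ cube d n)
    (hin' : ∀ i, ∀ x ∈ Metric.closedBall (c i) 1, ∀ k, |x k| < side d n / 2 - radius d n)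
    {ω : Ω} (hfin : {i | X i ω ∈ cube d n}.Finite)
    (hord : ∀ i j : ℕ, j < i → ‖WithLp.ofLp (X j ω)‖ ≤ ‖WithLp.ofLp (X i ω)‖)
    (hN : 2 ≤ numNodes X n ω) :
    P.real {ω' | labelledGraph Z U a b (visibleGraph n (locations X n ω)) ω' ∉
        flippable a b (visibleGraph n (locations X n ω))} ≤
      ∏ i, cellFactor r C (radius d n) X (c i) ω := by
  classical
  set R := radius d n
  set v := visibleGraph n (locations X n ω)
  have hnode : ∀ i, X i ω ∈ cube d n ↔ i < numNodes X n ω :=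
    mem_iff_lt_ncard hfin fun i j hji hi =>
      mem_cube_iff.2 ((hord i j hji).trans (mem_cube_iff.1 hi))
  let I' := {i : I // count X (Metric.closedBall (c i) 1) ω = 1}
  have hex : ∀ i : I', ∃ j : Fin (numNodes X n ω),
      {k | X k ω ∈ Metric.closedBall (c i) 1} = {(j : ℕ)} := by
    intro i
    obtain ⟨j, hj⟩ := Set.encard_eq_one.1 i.2
    have hjm : X j ω ∈ Metric.closedBall (c i) 1 := by
      have : j ∈ {k | X k ω ∈ Metric.closedBall (c i) 1} := by rw [hj]; rfl
      exact this
    refine ⟨⟨j, (hnode j).1 (hin i _ ?_)⟩, hj⟩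
    exact Metric.closedBall_subset_closedBall (by linarith) hjm
  choose g hg using hex
  have hgm : ∀ i : I', X (g i) ω ∈ Metric.closedBall (c i) 1 := by
    intro i
    have : (g i : ℕ) ∈ {k | X k ω ∈ Metric.closedBall (c i) 1} := by rw [hg]; rfl
    exact this
  have hadj : ∀ (i : I') j, v.Adj (g i) j → X j ω ∈ Metric.closedBall (c i) (R + 1) := by
    rintro i j ⟨-, hd⟩
    have := dist_le_of_torusDist_le (hin' i _ (hgm i)) ((hnode j).2 j.2) hd
    rw [Metric.mem_closedBall, dist_comm]
    have h2 := Metric.mem_closedBall'.1 (hgm i)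
    have h3 := dist_triangle (c i) (X (g i) ω) (X j ω)
    linarith
  have hdisj : ∀ i i' : I', ∀ x, x ∈ Metric.closedBall (c i) (R + 1) →
      x ∈ Metric.closedBall (c i') (R + 1) → i = i' := by
    intro i i' x h1 h2
    by_contra hne
    have := hsep i i' fun h => hne (Subtype.ext h)
    rw [Metric.mem_closedBall'] at h1
    rw [Metric.mem_closedBall] at h2
    have := dist_triangle (c i) x (c i')
    linarith
  have hsub : ∀ i : I', Metric.closedBall (c i) 1 ⊆ Metric.closedBall (c i) (R + 1) :=
    fun i => Metric.closedBall_subset_closedBall (by linarith)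
  have hmain := h.real_not_flippable_le hb hba ha hrC hN v g
    (fun i i' hii => hdisj i i' _ (hsub _ (hgm i)) (hii ▸ hsub _ (hgm i')))
    (fun i i' hii => by
      obtain rfl := hdisj i i' _ (hadj _ _ hii) (hsub _ (hgm i'))
      exact v.loopless.irrefl _ hii)
    (fun i i' j h1 h2 => hdisj i i' _ (hadj _ _ h1) (hadj _ _ h2))
  have hcard : ∀ i : I', (v.neighborSet (g i)).ncard ≤ (count X (annulus R (c i)) ω).toNat := by
    intro i
    have hsubset : (fun j : Fin (numNodes X n ω) => (j : ℕ)) '' v.neighborSet (g i) ⊆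
        {k | X k ω ∈ annulus R (c i)} := by
      rintro _ ⟨j, hj, rfl⟩
      refine ⟨hadj i j hj, fun hj1 => ?_⟩
      have : (j : ℕ) ∈ ({(g i : ℕ)} : Set ℕ) := hg i ▸ hj1
      exact (v.ne_of_adj hj) (Fin.ext (Set.mem_singleton_iff.1 this).symm)
    rw [← Set.ncard_image_of_injective _ Fin.val_injective]
    exact Set.ncard_le_ncard hsubset (hfin.subset fun k hk => hin i _ hk.1)
  -- Nonnegativity of the factors is needed to compare the products factor by factor, and uses `C ≤
  -- 1` and `r ≤ 1`.
  have h01 : ∀ m : ℕ, 0 ≤ 1 - C * r ^ m := fun m => by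
    have := mul_le_one₀ hC1 (by positivity) (pow_le_one₀ (n := m) hr0 hr1)
    linarith
  calc _ ≤ ∏ i : I', (1 - C * r ^ (v.neighborSet (g i)).ncard) := hmain
    _ ≤ ∏ i : I', (1 - C * r ^ (count X (annulus R (c i)) ω).toNat) := by
        refine Finset.prod_le_prod (fun i _ => h01 _) fun i _ => ?_
        have := pow_le_pow_of_le_one hr0 hr1 (hcard i)
        have := mul_le_mul_of_nonneg_left this hC0
        linarith
    _ = ∏ i, cellFactor r C R X (c i) ω := by
        unfold cellFactor
        rw [← Finset.prod_filter]
        exact (Finset.prod_subtype _ (by simp) fun i : I =>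
          1 - C * r ^ (count X (annulus R (c i)) ω).toNat).symm

end Cells

/-! ### Poisson counts and the expectation of the cell factors -/

open scoped NNReal

lemma integral_pow_poissonMeasure (m : ℝ≥0) (r : ℝ) :
    ∫ k, r ^ k ∂(poissonMeasure m) = Real.exp (-(m * (1 - r))) := by
  rw [integral_poissonMeasure]
  have h : ∀ k : ℕ, (Real.exp (-m) * (m : ℝ) ^ k / (Nat.factorial k)) • r ^ k =
      Real.exp (-m) * ((m * r) ^ k / (Nat.factorial k)) := by
    intro k
    rw [smul_eq_mul, mul_pow]
    ring
  simp only [h]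
  rw [tsum_mul_left]
  have := congrFun NormedSpace.exp_eq_tsum_div ((m : ℝ) * r)
  rw [← this, ← Real.exp_eq_exp_ℝ, ← Real.exp_add]
  congr 1
  ring

section Counts

variable {Ω : Type*} [MeasurableSpace Ω] {P : Measure Ω} {d : ℕ} {lam : ℝ}
  {X : ℕ → Ω → Space d}

lemma IsPoissonProcess.real_count (h : IsPoissonProcess P lam X) {B : Set (Space d)}
    (hB : MeasurableSet B) (hb : Bornology.IsBounded B) (k : ℕ) :
    P.real {ω | count X B ω = k} =
      (poissonMeasure (lam * volume.real B).toNNReal).real {k} := by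
  have hs : {x : ℕ∞ | x = k} = {(k : ℕ∞)} := by
    ext
    simp
  rw [(h.law_count B hB hb).measureReal_eq (p := (· = (k : ℕ∞))) (measurableSet_singleton _), hs,
    map_measureReal_apply .of_discrete (measurableSet_singleton _)]
  congr 1
  ext
  simp

lemma IsPoissonProcess.ae_count_ne_top (h : IsPoissonProcess P lam X) {B : Set (Space d)}
    (hB : MeasurableSet B) (hb : Bornology.IsBounded B) : ∀ᵐ ω ∂P, count X B ω ≠ ⊤ := by
  rw [ae_iff]
  simp only [not_not]
  have hs : {x : ℕ∞ | x = ⊤} = {(⊤ : ℕ∞)} := by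
    ext
    simp
  rw [(h.law_count B hB hb).measure_eq (p := (· = ⊤)) (measurableSet_singleton _), hs,
    Measure.map_apply .of_discrete (measurableSet_singleton _)]
  convert! measure_empty
  · ext; simp
  · infer_instance

lemma IsPoissonProcess.integral_pow_count (h : IsPoissonProcess P lam X) (hlam : 0 ≤ lam)
    {B : Set (Space d)} (hB : MeasurableSet B) (hb : Bornology.IsBounded B) (r : ℝ) :
    ∫ ω, r ^ (count X B ω).toNat ∂P = Real.exp (-(lam * volume.real B * (1 - r))) := by
  have hl := h.law_count B hB hb
  have := hl.integral_comp (f := fun k : ℕ∞ => r ^ k.toNat)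
    (Measurable.of_discrete).aestronglyMeasurable
  rw [Function.comp_def] at this
  rw [this, integral_map Measurable.of_discrete.aemeasurable (Measurable.of_discrete).aestronglyMeasurable]
  simp only [ENat.toNat_natCast]
  rw [integral_pow_poissonMeasure, Real.coe_toNNReal _ (by positivity)]

lemma measurableSet_annulus (R : ℝ) (c : Space d) : MeasurableSet (annulus R c) :=
  Metric.isClosed_closedBall.measurableSet.diff Metric.isClosed_closedBall.measurableSet

lemma isBounded_annulus (R : ℝ) (c : Space d) : Bornology.IsBounded (annulus R c) :=
  Metric.isBounded_closedBall.subset Set.sdiff_subset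

/-- The two regions of a cell. -/
def cellRegion (R : ℝ) (c : Space d) : Bool → Set (Space d)
  | true => Metric.closedBall c 1
  | false => annulus R c

lemma measurableSet_cellRegion (R : ℝ) (c : Space d) (s : Bool) :
    MeasurableSet (cellRegion R c s) := by
  cases s
  exacts [measurableSet_annulus R c, Metric.isClosed_closedBall.measurableSet]

/-- All unit balls and annuli are mutually disjoint. Indexing by a sigma type allows the two counts
of a cell to be grouped by `iIndepFun_curry` later. -/
lemma IsPoissonProcess.iIndepFun_count_cellRegion (h : IsPoissonProcess P lam X) {R : ℝ}
    (hR : 0 ≤ R) {I : Type*} [Fintype I] {c : I → Space d}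
    (hsep : ∀ i i', i ≠ i' → 2 * (R + 1) < dist (c i) (c i')) :
    iIndepFun (fun p : (_ : I) × Bool => count X (cellRegion R (c p.1) p.2)) P := by
  have hbd : ∀ c s, Bornology.IsBounded (cellRegion (d := d) R c s) := by
    rintro c (_ | _)
    exacts [isBounded_annulus R c, Metric.isBounded_closedBall]
  have hsub : ∀ c s, cellRegion (d := d) R c s ⊆ Metric.closedBall c (R + 1) := by
    rintro c (_ | _)
    exacts [Set.sdiff_subset, Metric.closedBall_subset_closedBall (by linarith)]
  have hdisj : ∀ p q : (_ : I) × Bool, p ≠ q →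
      Disjoint (cellRegion R (c p.1) p.2) (cellRegion R (c q.1) q.2) := by
    rintro ⟨i, s⟩ ⟨i', s'⟩ hne
    by_cases hi : i = i'
    · subst hi
      cases s <;> cases s' <;> simp only [ne_eq, not_true_eq_false] at hne
      · exact Set.disjoint_sdiff_left
      · exact Set.disjoint_sdiff_right
    · refine Set.disjoint_of_subset (hsub _ _) (hsub _ _) (Metric.closedBall_disjoint_closedBall ?_)
      have := hsep i i' hi
      linarith
  let e := Fintype.equivFin ((_ : I) × Bool)
  have := h.indep_count _ (fun k => cellRegion R (c (e.symm k).1) (e.symm k).2)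
    (fun _ => measurableSet_cellRegion _ _ _) (fun _ => hbd _ _) (fun k k' hk => hdisj _ _ (e.symm.injective.ne hk))
  have := this.precomp e.injective
  simpa only [Equiv.symm_apply_apply] using this

/-- The event of one point in the unit ball is independent of the annulus count, and the exponential
is the Poisson generating function at `r`. -/
lemma IsPoissonProcess.integral_cellFactor [IsProbabilityMeasure P] (h : IsPoissonProcess P lam X)
    (hlam : 0 ≤ lam) {R : ℝ} (hR : 0 ≤ R) {r : ℝ} (hr0 : 0 ≤ r) (hr1 : r ≤ 1) (C : ℝ)
    (c : Space d) :
    ∫ ω, cellFactor r C R X c ω ∂P =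
      1 - C * ((poissonMeasure (lam * volume.real (Metric.closedBall c 1)).toNNReal).real {1} *
        Real.exp (-(lam * volume.real (annulus R c) * (1 - r)))) := by
  have hQ := Metric.isClosed_closedBall (x := c) (ε := 1) |>.measurableSet
  have hind : IndepFun (count X (Metric.closedBall c 1)) (count X (annulus R c)) P :=
    (h.iIndepFun_count_cellRegion hR (I := Unit) (c := fun _ => c)
      (fun i i' hne => absurd rfl hne)).indepFun (i := ⟨(), true⟩) (j := ⟨(), false⟩) (by simp)
  let u : ℕ∞ → ℝ := fun k => if k = 1 then 1 else 0
  let w : ℕ∞ → ℝ := fun k => r ^ k.toNat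
  have hu : ∀ k, |u k| ≤ 1 := fun k => by
    simp only [u]
    split_ifs <;> simp
  have hw : ∀ k, |w k| ≤ 1 := fun k => by
    simp only [w, abs_pow, abs_of_nonneg hr0]
    exact pow_le_one₀ hr0 hr1
  have hmQ := measurable_count h.measurable hQ
  have hmA := measurable_count h.measurable (measurableSet_annulus R c)
  have hcell : ∀ ω, cellFactor r C R X c ω =
      1 - C * (u (count X (Metric.closedBall c 1) ω) * w (count X (annulus R c) ω)) := by
    intro ω
    simp only [cellFactor, u, w]
    split_ifs <;> simp
  have hmeas : Measurable fun ω =>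
      u (count X (Metric.closedBall c 1) ω) * w (count X (annulus R c) ω) :=
    ((Measurable.of_discrete (f := u)).comp hmQ).mul ((Measurable.of_discrete (f := w)).comp hmA)
  have hint : Integrable
      (fun ω => u (count X (Metric.closedBall c 1) ω) * w (count X (annulus R c) ω)) P := by
    refine Integrable.of_bound hmeas.aestronglyMeasurable 1 (ae_of_all _ fun ω => ?_)
    rw [Real.norm_eq_abs, abs_mul]
    exact mul_le_one₀ (hu _) (abs_nonneg _) (hw _)
  simp only [hcell]
  rw [integral_sub (integrable_const _) (hint.const_mul C), integral_const_mul,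
    hind.integral_fun_comp_mul_comp (f := u) (g := w) hmQ.aemeasurable hmA.aemeasurable
      (Measurable.of_discrete).aestronglyMeasurable (Measurable.of_discrete).aestronglyMeasurable,
    h.integral_pow_count hlam (measurableSet_annulus R c) (isBounded_annulus R c)]
  have h1 : ∫ ω, u (count X (Metric.closedBall c 1) ω) ∂P =
      (poissonMeasure (lam * volume.real (Metric.closedBall c 1)).toNNReal).real {1} := by
    have hs : {ω | count X (Metric.closedBall c 1) ω = ((1 : ℕ) : ℕ∞)} =
        count X (Metric.closedBall c 1) ⁻¹' {1} := by
      ext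
      simp
    rw [← h.real_count hQ Metric.isBounded_closedBall, hs, ← integral_indicator_one
      (hmQ (measurableSet_singleton _))]
    refine integral_congr_ae (ae_of_all _ fun ω => ?_)
    simp [u, Set.indicator]
  rw [h1]
  simp

lemma IsPoissonProcess.integral_prod_cellFactor [IsProbabilityMeasure P]
    (h : IsPoissonProcess P lam X) {R : ℝ}
    (hR : 0 ≤ R) {I : Type*} [Fintype I] {c : I → Space d}
    (hsep : ∀ i i', i ≠ i' → 2 * (R + 1) < dist (c i) (c i')) (r C : ℝ) :
    ∫ ω, ∏ i, cellFactor r C R X (c i) ω ∂P = ∏ i, ∫ ω, cellFactor r C R X (c i) ω ∂P := by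
  have hm : ∀ i s, Measurable (count X (cellRegion R (c i) s)) := fun i s =>
    measurable_count h.measurable (measurableSet_cellRegion _ _ _)
  have hind := iIndepFun_curry (Y := fun i s ω => count X (cellRegion R (c i) s) ω) hm
    (h.iIndepFun_count_cellRegion hR hsep)
  exact hind.integral_fun_prod_comp (f := fun _ (k : Bool → ℕ∞) =>
      if k true = 1 then 1 - C * r ^ (k false).toNat else (1 : ℝ))
    (fun i => (measurable_pi_lambda _ (hm i)).aemeasurable)
    (fun i => (measurable_of_countable _).aestronglyMeasurable)

end Counts

/-! ### Volumes, and a grid of cell centres -/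

section Volume

variable {d : ℕ}

lemma unitBallVolume_pos (d : ℕ) : 0 < unitBallVolume d :=
  ENNReal.toReal_pos (Metric.measure_ball_pos _ _ one_pos).ne' measure_ball_lt_top.ne

lemma volume_real_closedBall (c : Space d) {R : ℝ} (hR : 0 ≤ R) :
    volume.real (Metric.closedBall c R) = R ^ d * unitBallVolume d := by
  rw [Measure.addHaar_real_closedBall _ _ hR, finrank_euclideanSpace_fin, unitBallVolume]

lemma volume_real_annulus_le (c : Space d) {R : ℝ} (hR : 0 ≤ R) :
    volume.real (annulus R c) ≤ (R + 1) ^ d * unitBallVolume d := by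
  rw [← volume_real_closedBall c (by linarith)]
  exact measureReal_mono Set.sdiff_subset measure_closedBall_lt_top.ne

lemma side_pow {d : ℕ} (hd : 1 ≤ d) (n : ℕ) : side d n ^ d = n := by
  rw [side, one_div, Real.rpow_inv_natCast_pow (Nat.cast_nonneg n) (by omega)]

lemma radius_pow {d : ℕ} (hd : 1 ≤ d) (n : ℕ) : radius d n ^ d = Real.log n := by
  rw [radius, one_div, Real.rpow_inv_natCast_pow (Real.log_natCast_nonneg n) (by omega)]

lemma radius_nonneg (d n : ℕ) : 0 ≤ radius d n := Real.rpow_nonneg (Real.log_natCast_nonneg n) _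

/-- The centres of a grid of cells. -/
def cellCentre (d : ℕ) (w : ℝ) (K : ℕ) (i : Fin d → Fin K) : Space d :=
  WithLp.toLp 2 fun k => w * ((i k : ℕ) + 1)

lemma abs_sub_le_dist (x y : Space d) (k : Fin d) : |x k - y k| ≤ dist x y := by
  rw [dist_eq_norm]
  exact PiLp.norm_apply_le (p := 2) (x - y) k

lemma le_dist_cellCentre {w : ℝ} (hw : 0 ≤ w) {K : ℕ} {i i' : Fin d → Fin K} (h : i ≠ i') :
    w ≤ dist (cellCentre d w K i) (cellCentre d w K i') := by
  obtain ⟨k, hk⟩ := Function.ne_iff.1 h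
  refine le_trans ?_ (abs_sub_le_dist _ _ k)
  have h1 : (1 : ℝ) ≤ |((i k : ℕ) : ℝ) - ((i' k : ℕ) : ℝ)| := by
    have h2 : ((i k : ℕ) : ℤ) - ((i' k : ℕ) : ℤ) ≠ 0 := by
      have := Fin.val_ne_of_ne hk
      omega
    exact_mod_cast Int.one_le_abs h2
  have h3 : (cellCentre d w K i) k - (cellCentre d w K i') k =
      w * (((i k : ℕ) : ℝ) - ((i' k : ℕ) : ℝ)) := by
    simp only [cellCentre]
    ring
  rw [h3, abs_mul, abs_of_nonneg hw]
  exact le_mul_of_one_le_right hw h1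

lemma abs_le_of_mem_cell {w ρ : ℝ} (hw : 0 ≤ w) {K : ℕ} {i : Fin d → Fin K} {x : Space d}
    (hx : x ∈ Metric.closedBall (cellCentre d w K i) ρ) (k : Fin d) : |x k| ≤ w * K + ρ := by
  have h1 := (abs_sub_le_dist x (cellCentre d w K i) k).trans (Metric.mem_closedBall.1 hx)
  have h2 : |(cellCentre d w K i) k| ≤ w * K := by
    rw [abs_of_nonneg (by simp only [cellCentre]; positivity)]
    simp only [cellCentre]
    refine mul_le_mul_of_nonneg_left ?_ hw
    exact_mod_cast (i k).2
  have h3 := abs_add_le (x k - (cellCentre d w K i) k) ((cellCentre d w K i) k)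
  rw [sub_add_cancel] at h3
  linarith

end Volume

/-! ### Bounds for finite `n` -/

section Bounds

variable {Ω : Type*} [MeasurableSpace Ω] {P : Measure Ω} {d : ℕ} {lam : ℝ}
  {X : ℕ → Ω → Space d} {Z : ℕ → Ω → ℤˣ} {U : Sym2 ℕ → Ω → ℝ}

lemma IsMarkedPoissonProcess.measurableSet_pattern
    (h : IsMarkedPoissonProcess P lam X Z U) (a b : ℝ) (n : ℕ)
    {τ : (N : ℕ) → (Fin N → Space d) → SimpleGraph (Fin N) → (Fin N → ℤˣ)}
    (hτ : ∀ N G, Measurable (fun x => τ N x G))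
    (S : (t : Pattern) → Set ((Fin t.1 → ℤˣ) × SimpleGraph (Fin t.1))) :
    MeasurableSet
      {ω | labelledGraph Z U a b (pattern n τ X ω).2.1 ω ∈ S (pattern n τ X ω)} := by
  have : {ω | labelledGraph Z U a b (pattern n τ X ω).2.1 ω ∈ S (pattern n τ X ω)} =
      ⋃ t, pattern n τ X ⁻¹' {t} ∩ {ω | labelledGraph Z U a b t.2.1 ω ∈ S t} := by
    ext ω
    simp only [Set.mem_ofPred_eq, Set.mem_iUnion, Set.mem_inter_iff, Set.mem_preimage,
      Set.mem_singleton_iff]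
    constructor
    · exact fun hω => ⟨_, rfl, hω⟩
    · rintro ⟨t, rfl, hω⟩
      exact hω
  rw [this]
  exact MeasurableSet.iUnion fun t =>
    (measurable_pattern h.poisson.measurable n hτ (measurableSet_singleton t)).inter
      (measurableSet_labelledGraph h.measurable_Z (fun e => h.measurable_U e) _ _ _ _)

/-- The count in the inscribed Euclidean ball is a lower bound for the number of nodes, and the
bound is its Poisson probability of being zero or one. -/
lemma IsPoissonProcess.real_numNodes_lt_two_le [IsProbabilityMeasure P]
    (h : IsPoissonProcess P lam X) (hlam : 0 ≤ lam) (hd : 1 ≤ d) (n : ℕ) :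
    P.real {ω | numNodes X n ω < 2} ≤
      Real.exp (-(lam * unitBallVolume d / 2 ^ d * n)) +
        lam * unitBallVolume d / 2 ^ d * n * Real.exp (-(lam * unitBallVolume d / 2 ^ d * n)) := by
  set B := Metric.closedBall (0 : Space d) (side d n / 2) with hB
  have hs := side_nonneg d n
  have hvol : lam * volume.real B = lam * unitBallVolume d / 2 ^ d * n := by
    rw [hB, volume_real_closedBall _ (by positivity), div_pow, side_pow hd]
    ring
  have hBm : MeasurableSet B := Metric.isClosed_closedBall.measurableSet
  have hBb : Bornology.IsBounded B := Metric.isBounded_closedBall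
  have hsub : B ⊆ cube d n := by
    intro x hx k
    have h1 := (abs_sub_le_dist x 0 k).trans (Metric.mem_closedBall.1 hx)
    rw [PiLp.zero_apply, sub_zero] at h1
    exact abs_le.1 h1
  have hle : P.real {ω | numNodes X n ω < 2} ≤
      P.real ({ω | count X B ω = (0 : ℕ)} ∪ {ω | count X B ω = (1 : ℕ)}) := by
    refine ENNReal.toReal_mono (measure_ne_top _ _) (measure_mono_ae ?_)
    filter_upwards [h.ae_count_ne_top (measurableSet_cube d n) (isBounded_cube d n)] with ω hω hlt
    have h1 : count X B ω ≤ count X (cube d n) ω := Set.encard_le_encard fun i hi => hsub hi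
    obtain ⟨k, hk⟩ := ENat.ne_top_iff_exists.1 hω
    have hlt' : numNodes X n ω < 2 := hlt
    rw [numNodes_eq, ← hk, ENat.toNat_natCast] at hlt'
    rw [← hk] at h1
    obtain ⟨m, hm⟩ := ENat.ne_top_iff_exists.1 (ne_top_of_le_ne_top (ENat.natCast_ne_top k) h1)
    rw [← hm] at h1
    have h2 : m ≤ k := by exact_mod_cast h1
    change count X B ω = (0 : ℕ) ∨ count X B ω = (1 : ℕ)
    rw [← hm]
    have : m = 0 ∨ m = 1 := by omega
    rcases this with rfl | rfl
    exacts [Or.inl rfl, Or.inr rfl]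
  refine hle.trans ((measureReal_union_le _ _).trans (le_of_eq ?_))
  have hpos : 0 ≤ lam * volume.real B := mul_nonneg hlam measureReal_nonneg
  rw [h.real_count hBm hBb, h.real_count hBm hBb, poissonMeasure_real_singleton,
    poissonMeasure_real_singleton, Real.coe_toNNReal _ hpos, hvol]
  simp
  ring

lemma cellFactor_nonneg {Ω : Type*} {r C : ℝ} (hr0 : 0 ≤ r) (hr1 : r ≤ 1) (hC1 : C ≤ 1) (R : ℝ)
    (X : ℕ → Ω → Space d) (c : Space d) (ω : Ω) : 0 ≤ cellFactor r C R X c ω := by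
  unfold cellFactor
  split_ifs
  · have h1 := pow_le_one₀ (n := (count X (annulus R c) ω).toNat) hr0 hr1
    have h2 : 0 ≤ r ^ (count X (annulus R c) ω).toNat := by positivity
    nlinarith
  · exact zero_le_one

lemma cellFactor_le_one {Ω : Type*} {r C : ℝ} (hr0 : 0 ≤ r) (hC0 : 0 ≤ C) (R : ℝ)
    (X : ℕ → Ω → Space d) (c : Space d) (ω : Ω) : cellFactor r C R X c ω ≤ 1 := by
  unfold cellFactor
  split_ifs
  · have : 0 ≤ C * r ^ (count X (annulus R c) ω).toNat := by positivity
    linarith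
  · exact le_rfl

lemma measurable_cellFactor (hX : ∀ i, Measurable (X i)) (r C R : ℝ) (c : Space d) :
    Measurable (cellFactor r C R X c) := by
  refine Measurable.ite ?_ ?_ measurable_const
  · exact measurable_count hX Metric.isClosed_closedBall.measurableSet (measurableSet_singleton 1)
  · exact (Measurable.of_discrete (f := fun k : ℕ∞ => 1 - C * r ^ k.toNat)).comp
      (measurable_count hX (measurableSet_annulus R c))

/-- Averaging the conditional bound over the locations: the cell factors are independent, and each
has mean at most `1 - p ≤ exp (-p)`, with `p` a lower bound for the success probability of one cell.
-/
lemma IsMarkedPoissonProcess.real_not_flippable_pattern_le [IsProbabilityMeasure P]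
    (h : IsMarkedPoissonProcess P lam X Z U) (hlam : 0 ≤ lam) {a b : ℝ} (hb : 0 ≤ b) (hba : b < a)
    (ha : a ≤ 1) {r C : ℝ} (hr0 : 0 ≤ r) (hr1 : r ≤ 1) (hC0 : 0 ≤ C) (hC1 : C ≤ 1)
    (hrC : ∀ (J : Type) [Fintype J] [DecidableEq J], ∀ A : Finset (J → ℤˣ × Bool),
        (∀ σ, σ ∈ A ↔ σ ∈ ambiguous a b J) →
        C * r ^ Fintype.card J ≤ ∑ σ ∈ A, ∏ j, edgeWeight a b (σ j) / 2)
    (n : ℕ) {τ : (N : ℕ) → (Fin N → Space d) → SimpleGraph (Fin N) → (Fin N → ℤˣ)}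
    (hτ : ∀ N G, Measurable (fun x => τ N x G)) {K : ℕ}
    (hK : (2 * radius d n + 3) * (K + 1) ≤ side d n / 2) :
    P.real {ω | labelledGraph Z U a b (pattern n τ X ω).2.1 ω ∉
        flippable a b (pattern n τ X ω).2.1} ≤
      P.real {ω | numNodes X n ω < 2} +
        Real.exp (-((K : ℝ) ^ d * (C * ((poissonMeasure
          (lam * unitBallVolume d).toNNReal).real {1} *
          Real.exp (-(lam * unitBallVolume d * (1 - r) * (radius d n + 1) ^ d)))))) := by
  classical
  set R := radius d n
  have hR : 0 ≤ R := radius_nonneg d n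
  -- The grid spacing: larger than `2 * (R + 1)`, so that the cells are disjoint. By `hK` it also
  -- leaves a margin `w` between the last centres and the boundary.
  set w := 2 * R + 3
  have hw0 : 0 ≤ w := by positivity
  let c := cellCentre d w K
  have hsep : ∀ i i', i ≠ i' → 2 * (R + 1) < dist (c i) (c i') := fun i i' hne =>
    lt_of_lt_of_le (by linarith) (le_dist_cellCentre hw0 hne)
  have hK' : w * K + w ≤ side d n / 2 := by linarith
  have hin : ∀ i, ∀ x ∈ Metric.closedBall (c i) (R + 1), x ∈ cube d n := fun i x hx k =>
    abs_le.1 ((abs_le_of_mem_cell hw0 hx k).trans (by linarith))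
  have hin' : ∀ i, ∀ x ∈ Metric.closedBall (c i) 1, ∀ k, |x k| < side d n / 2 - R :=
    fun i x hx k => (abs_le_of_mem_cell hw0 hx k).trans_lt (by linarith)
  have hmp := h.measure_pattern a b n hτ (fun t => (flippable a b t.2.1)ᶜ)
  let F : Ω → ℝ := fun ω => ∏ i, cellFactor r C R X (c i) ω
  -- With fewer than two nodes no labelled graph is flippable, so there the conditional probability
  -- is bounded trivially by one.
  let G : Ω → ℝ := {ω | numNodes X n ω < 2}.indicator 1
  have hF0 : ∀ ω, 0 ≤ F ω := fun ω =>
    Finset.prod_nonneg fun i _ => cellFactor_nonneg hr0 hr1 hC1 R X _ ω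
  have hF1 : ∀ ω, F ω ≤ 1 := fun ω =>
    Finset.prod_le_one (fun i _ => cellFactor_nonneg hr0 hr1 hC1 R X _ ω)
      fun i _ => cellFactor_le_one hr0 hC0 R X _ ω
  have hG0 : ∀ ω, 0 ≤ G ω := fun ω => Set.indicator_nonneg (fun _ _ => zero_le_one) ω
  have hNm : MeasurableSet {ω | numNodes X n ω < 2} :=
    measurable_numNodes h.poisson.measurable n (measurableSet_Iio (a := 2))
  have hFint : Integrable F P := by
    refine Integrable.of_bound (Measurable.aestronglyMeasurable ?_) 1 (ae_of_all _ fun ω => ?_)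
    · exact Finset.measurable_fun_prod _ fun i _ =>
        measurable_cellFactor h.poisson.measurable r C R (c i)
    · rw [Real.norm_of_nonneg (hF0 ω)]
      exact hF1 ω
  have hGint : Integrable G P := (integrable_const 1).indicator hNm
  have hpt : ∀ᵐ ω ∂P, P {ω' | labelledGraph Z U a b (pattern n τ X ω).2.1 ω' ∈
      (flippable a b (pattern n τ X ω).2.1)ᶜ} ≤ ENNReal.ofReal (G ω + F ω) := by
    filter_upwards [h.ordered, h.poisson.ae_count_ne_top (measurableSet_cube d n)
      (isBounded_cube d n)] with ω hord htop
    refine (ENNReal.le_ofReal_iff_toReal_le (measure_ne_top _ _)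
      (add_nonneg (hG0 ω) (hF0 ω))).2 ?_
    by_cases hN : numNodes X n ω < 2
    · have h1 : G ω = 1 :=
        Set.indicator_of_mem (s := {ω | numNodes X n ω < 2}) (f := (1 : Ω → ℝ)) hN
      rw [h1]
      have h2 : P.real {ω' | labelledGraph Z U a b (pattern n τ X ω).2.1 ω' ∈
        (flippable a b (pattern n τ X ω).2.1)ᶜ} ≤ 1 := measureReal_le_one
      have := hF0 ω
      rw [measureReal_def] at h2
      linarith
    · have h1 := h.real_not_flippable_le_prod hb hba ha hr0 hr1 hC0 hC1 hrC hR hsep hin hin'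
        (Set.encard_ne_top_iff.1 htop) hord (not_lt.1 hN)
      exact h1.trans (le_add_of_nonneg_left (hG0 ω))
  have hbound : P.real {ω | labelledGraph Z U a b (pattern n τ X ω).2.1 ω ∉
        flippable a b (pattern n τ X ω).2.1} ≤ ∫ ω, (G ω + F ω) ∂P := by
    refine ENNReal.toReal_le_of_le_ofReal
      (integral_nonneg fun ω => add_nonneg (hG0 ω) (hF0 ω)) ?_
    have hGF := ofReal_integral_eq_lintegral_ofReal (f := fun ω => G ω + F ω) (hGint.add hFint)
      (ae_of_all _ fun ω => add_nonneg (hG0 ω) (hF0 ω))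
    rw [hGF]
    exact hmp.trans_le (lintegral_mono_ae hpt)
  refine hbound.trans ?_
  rw [integral_add hGint hFint]
  have hGi : ∫ ω, G ω ∂P = P.real {ω | numNodes X n ω < 2} := integral_indicator_one hNm
  rw [hGi]
  refine add_le_add le_rfl ?_
  set p := C * ((poissonMeasure (lam * unitBallVolume d).toNNReal).real {1} *
          Real.exp (-(lam * unitBallVolume d * (1 - r) * (R + 1) ^ d))) with hp
  have hone : ∀ i, ∫ ω, cellFactor r C R X (c i) ω ∂P ≤ Real.exp (-p) := by
    intro i
    rw [h.poisson.integral_cellFactor hlam hR hr0 hr1 C, volume_real_closedBall _ zero_le_one,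
      one_pow, one_mul]
    refine le_trans (sub_le_sub_left ?_ 1) (Real.one_sub_le_exp_neg p)
    rw [hp]
    refine mul_le_mul_of_nonneg_left (mul_le_mul_of_nonneg_left (Real.exp_le_exp.2 ?_)
      measureReal_nonneg) hC0
    -- The annulus is replaced by the full ball of radius `R + 1`, which only lowers the success
    -- probability.
    rw [neg_le_neg_iff]
    have h1 := volume_real_annulus_le (c i) hR
    have h2 : 0 ≤ lam * (1 - r) := mul_nonneg hlam (by linarith)
    nlinarith [mul_le_mul_of_nonneg_left h1 h2]
  have hprod : ∫ ω, F ω ∂P = ∏ i, ∫ ω, cellFactor r C R X (c i) ω ∂P :=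
    h.poisson.integral_prod_cellFactor hR hsep r C
  rw [hprod]
  calc ∏ i, ∫ ω, cellFactor r C R X (c i) ω ∂P ≤ ∏ _i : Fin d → Fin K, Real.exp (-p) :=
        Finset.prod_le_prod (fun i _ => integral_nonneg fun ω =>
          cellFactor_nonneg hr0 hr1 hC1 R X _ ω) fun i _ => hone i
    _ = Real.exp (-((K : ℝ) ^ d * p)) := by
        rw [Finset.prod_const, Finset.card_univ, Fintype.card_fun, Fintype.card_fin,
          Fintype.card_fin, ← Real.exp_nat_mul]
        push_cast
        congr 1
        ring

end Bounds

/-! ### Asymptotics of the number of cells against the success probability -/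

lemma exists_grid_size {d : ℕ} (hd : 1 ≤ d) {κ A : ℝ} (hκ : κ < 1) (hA : 0 < A) :
    ∃ K : ℕ → ℕ, (∀ᶠ n in atTop, (2 * radius d n + 3) * (K n + 1) ≤ side d n / 2) ∧
      Tendsto (fun n => (K n : ℝ) ^ d * (A * Real.exp (-(κ * (radius d n + 1) ^ d)))) atTop
        atTop := by
  have hlog : Tendsto (fun n : ℕ => Real.log n) atTop atTop :=
    Real.tendsto_log_atTop.comp tendsto_natCast_atTop_atTop
  have hRtop : Tendsto (radius d) atTop atTop :=
    (tendsto_rpow_atTop (by positivity)).comp hlog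
  -- Room between `κ` and one: passing from `κ` to `θ` absorbs the replacement of `log n` by `(R +
  -- 1) ^ d`. Of the remaining `1 - θ = 2 * δ`, one `δ` pays for the factor `log n` and the other
  -- gives the divergence.
  set θ := (1 + κ) / 2 with hθ
  set δ := (1 - θ) / 2 with hδ
  have hδ0 : 0 < δ := by rw [hδ, hθ]; linarith
  have h1 : ∀ᶠ n in atTop, 1 ≤ radius d n := hRtop.eventually_ge_atTop 1
  have h2 : ∀ᶠ n : ℕ in atTop, 40 ^ d * Real.log n ≤ n := by
    have := (Real.isLittleO_log_id_atTop.bound (c := 1 / 40 ^ d) (by positivity))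
    filter_upwards [tendsto_natCast_atTop_atTop.eventually this] with n hn
    rw [Real.norm_of_nonneg (Real.log_natCast_nonneg n), id, Real.norm_of_nonneg (by positivity),
      one_div, le_inv_mul_iff₀ (by positivity)] at hn
    exact hn
  have h3 : ∀ᶠ n in atTop, κ * (1 + (radius d n)⁻¹) ^ d ≤ θ := by
    have ht : Tendsto (fun n => κ * (1 + (radius d n)⁻¹) ^ d) atTop (𝓝 (κ * (1 + 0) ^ d)) :=
      ((hRtop.inv_tendsto_atTop.const_add 1).pow d).const_mul κ
    refine ht.eventually_le_const ?_
    rw [add_zero, one_pow, mul_one, hθ]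
    linarith
  have h4 : ∀ᶠ n : ℕ in atTop, Real.log n ≤ (n : ℝ) ^ δ := by
    have := ((isLittleO_log_rpow_atTop hδ0).bound (c := 1) one_pos)
    filter_upwards [tendsto_natCast_atTop_atTop.eventually this] with n hn
    rwa [Real.norm_of_nonneg (Real.log_natCast_nonneg n), one_mul,
      Real.norm_of_nonneg (by positivity)] at hn
  have hside : ∀ᶠ n in atTop, 40 * radius d n ≤ side d n := by
    filter_upwards [h2] with n hn
    rw [← pow_le_pow_iff_left₀ (mul_nonneg (by norm_num) (radius_nonneg d n)) (side_nonneg d n)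
      (by omega : d ≠ 0), mul_pow, radius_pow hd, side_pow hd]
    exact hn
  -- The factor `4` makes `K` steps use at most a quarter of the side, which leaves room for the
  -- additional step.
  refine ⟨fun n => ⌊side d n / (4 * (2 * radius d n + 3))⌋₊, ?_, ?_⟩
  · filter_upwards [h1, hside] with n hR hs
    have hw : 0 < 2 * radius d n + 3 := by linarith
    have hfl := Nat.floor_le (div_nonneg (side_nonneg d n) (by linarith :
      0 ≤ 4 * (2 * radius d n + 3)))
    rw [le_div_iff₀ (by linarith)] at hfl
    nlinarith
  · have hlim : Tendsto (fun n : ℕ => A / 40 ^ d * (n : ℝ) ^ δ) atTop atTop :=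
      ((tendsto_rpow_atTop hδ0).comp tendsto_natCast_atTop_atTop).const_mul_atTop (by positivity)
    refine tendsto_atTop_mono' _ ?_ hlim
    filter_upwards [h1, hside, h3, h4, eventually_ge_atTop 1] with n hR hs hθn hln hn
    have hnpos : (0 : ℝ) < n := by exact_mod_cast hn
    have hlogpos : 0 < Real.log n := by
      rw [← radius_pow hd]
      positivity
    set K := ⌊side d n / (4 * (2 * radius d n + 3))⌋₊
    -- For `R ≥ 1` the denominator `4 * (2 * R + 3)` is at most `20 * R`. The further factor two
    -- compensates for rounding down, since `side d n / (40 * R) ≥ 1`.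
    have hK1 : side d n / (40 * radius d n) ≤ K := by
      have hlt := Nat.lt_floor_add_one (side d n / (4 * (2 * radius d n + 3)))
      have hw : 0 < 4 * (2 * radius d n + 3) := by linarith
      have ha : 2 * (side d n / (40 * radius d n)) ≤ side d n / (4 * (2 * radius d n + 3)) := by
        rw [← mul_div_assoc, div_le_div_iff₀ (by linarith) hw]
        nlinarith [side_nonneg d n]
      have hb : 1 ≤ side d n / (40 * radius d n) := by
        rwa [one_le_div (by linarith)]
      have : side d n / (4 * (2 * radius d n + 3)) < K + 1 := hlt
      linarith
    have hKd : (n : ℝ) / (40 ^ d * Real.log n) ≤ (K : ℝ) ^ d := by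
      rw [← radius_pow hd, ← side_pow hd n, ← mul_pow, ← div_pow]
      refine pow_le_pow_left₀ (div_nonneg (side_nonneg d n) ?_) hK1 d
      linarith
    have hexp : (n : ℝ) ^ (-θ) ≤ Real.exp (-(κ * (radius d n + 1) ^ d)) := by
      rw [Real.rpow_def_of_pos hnpos, Real.exp_le_exp]
      have he : (radius d n + 1) ^ d = Real.log n * (1 + (radius d n)⁻¹) ^ d := by
        rw [← radius_pow hd, ← mul_pow, mul_add, mul_one, mul_inv_cancel₀ (by linarith)]
      rw [he]
      nlinarith
    have hsplit : (n : ℝ) ^ δ ≤ (n : ℝ) / Real.log n * (n : ℝ) ^ (-θ) := by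
      have hδθ : δ + δ = 1 + -θ := by rw [hδ]; ring
      have hpw : (n : ℝ) ^ δ * (n : ℝ) ^ δ = n * (n : ℝ) ^ (-θ) := by
        rw [← Real.rpow_add hnpos, hδθ, Real.rpow_add hnpos, Real.rpow_one]
      rw [div_mul_eq_mul_div, le_div_iff₀ hlogpos, ← hpw]
      exact mul_le_mul_of_nonneg_left hln (by positivity)
    calc A / 40 ^ d * (n : ℝ) ^ δ
        ≤ A / 40 ^ d * ((n : ℝ) / Real.log n * (n : ℝ) ^ (-θ)) := by gcongr
      _ = (n : ℝ) / (40 ^ d * Real.log n) * (A * (n : ℝ) ^ (-θ)) := by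
        field_simp
      _ ≤ _ := by gcongr

end PlantedPartition

/-! ### Conclusion -/

open PlantedPartition in
theorem theorem4 {Ω : Type*} [MeasurableSpace Ω] (P : Measure Ω) [IsProbabilityMeasure P]
    (d : ℕ) (hd : 1 ≤ d) (lam a b : ℝ) (hlam : 0 < lam) (hb : 0 ≤ b) (hba : b < a) (ha : a ≤ 1)
    (hcond : lam * PlantedPartition.unitBallVolume d *
      (1 - Real.sqrt (a * b) - Real.sqrt ((1 - a) * (1 - b))) < 1)
    (X : ℕ → Ω → PlantedPartition.Space d) (Z : ℕ → Ω → ℤˣ) (U : Sym2 ℕ → Ω → ℝ)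
    (hXZU : PlantedPartition.IsMarkedPoissonProcess P lam X Z U) :
    ¬ PlantedPartition.ExactRecoverySolvable P X Z U
      (PlantedPartition.logConn d a) (PlantedPartition.logConn d b) := by
  rintro ⟨τ, hτ, hlim⟩
  have hν := unitBallVolume_pos d
  obtain ⟨r, C, hr0, hr1, hC0, hC1, hκ, hrC⟩ := exists_rate hb hba ha hcond
  set A := C * (poissonMeasure (lam * unitBallVolume d).toNNReal).real {1} with hA
  have hA0 : 0 < A := mul_pos hC0
    (poissonMeasure_real_singleton_pos 1 (Real.toNNReal_pos.2 (mul_pos hlam hν)))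
  obtain ⟨K, hK, hKlim⟩ := exists_grid_size hd hκ hA0
  let s : ℕ → ℝ := fun n => P.real {ω | overlap (τ n (numNodes X n ω) (locations X n ω)
    (graph X Z U (logConn d a) (logConn d b) n ω)) (labels X Z n ω) = 1}
  have hs : Tendsto s atTop (𝓝 1) := (ENNReal.tendsto_toReal ENNReal.one_ne_top).comp hlim
  set μ := lam * unitBallVolume d / 2 ^ d
  have hμ0 : 0 < μ := by positivity
  have hμn : Tendsto (fun n : ℕ => μ * n) atTop atTop :=
    tendsto_natCast_atTop_atTop.const_mul_atTop hμ0
  have he1 : Tendsto (fun n : ℕ => Real.exp (-(μ * n))) atTop (𝓝 0) :=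
    Real.tendsto_exp_neg_atTop_nhds_zero.comp hμn
  have he2 : Tendsto (fun n : ℕ => μ * n * Real.exp (-(μ * n))) atTop (𝓝 0) := by
    have := (Real.tendsto_pow_mul_exp_neg_atTop_nhds_zero 1).comp hμn
    simpa only [Function.comp_def, pow_one] using this
  have he3 := Real.tendsto_exp_neg_atTop_nhds_zero.comp hKlim
  -- One is the probability of being flippable, at most three times the failure probability `1 - s
  -- n`, plus that of not being flippable. If `s n` tended to one, the right side would tend to
  -- zero.
  have hbound : ∀ᶠ n in atTop, (1 : ℝ) ≤ 3 * (1 - s n) + ((Real.exp (-(μ * n)) +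
      μ * n * Real.exp (-(μ * n))) + Real.exp (-((K n : ℝ) ^ d *
        (A * Real.exp (-(lam * unitBallVolume d * (1 - r) * (radius d n + 1) ^ d)))))) := by
    filter_upwards [hK] with n hKn
    have hτn : ∀ N G, Measurable (fun x => τ n N x G) := hτ n
    have h1 := hXZU.real_not_flippable_pattern_le hlam.le hb hba ha hr0 hr1 hC0.le hC1 hrC n hτn
      hKn
    have h2 := hXZU.poisson.real_numNodes_lt_two_le hlam.le hd n
    have h3 := hXZU.measure_flippable_le hb hba ha n hτn
    have h4 := probReal_compl_eq_one_sub (μ := P)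
      (hXZU.measurableSet_pattern a b n hτn (fun t => flippable a b t.2.1))
    have h5 := probReal_compl_eq_one_sub (μ := P)
      (hXZU.measurableSet_pattern a b n hτn (fun t => failure t.2.2))
    have h6 : P.real {ω | labelledGraph Z U a b (pattern n (τ n) X ω).2.1 ω ∈
        failure (pattern n (τ n) X ω).2.2}ᶜ = s n := by
      simp only [s, graph_eq_markGraph]
      congr 1
      ext ω
      exact not_not
    have h7 : P.real {ω | labelledGraph Z U a b (pattern n (τ n) X ω).2.1 ω ∈
        flippable a b (pattern n (τ n) X ω).2.1} ≤
        3 * P.real {ω | labelledGraph Z U a b (pattern n (τ n) X ω).2.1 ω ∈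
        failure (pattern n (τ n) X ω).2.2} := by
      have := ENNReal.toReal_mono (ENNReal.mul_ne_top (by norm_num) (measure_ne_top _ _)) h3
      rwa [ENNReal.toReal_mul] at this
    rw [h6] at h5
    rw [← mul_assoc C, ← hA] at h1
    have h8 : P.real {ω | labelledGraph Z U a b (pattern n (τ n) X ω).2.1 ω ∈
        flippable a b (pattern n (τ n) X ω).2.1}ᶜ ≤ _ := h1
    linarith
  have hzero := ((hs.const_sub 1).const_mul 3).add ((he1.add he2).add he3)
  have := ge_of_tendsto hzero hbound
  norm_num at this
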